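/- Let $\mathcal E$ be a Barr-exact category, let $\mathbb A,\mathbb B,\mathbb C$ be internal groupoids in $\mathcal E$, with domain and codomain maps written $d,c$, and let $S$ be an internal distributor between $\mathbb A$ and $\mathbb B$ and $T$ one between $\mathbb B$ and $\mathbb C$. That is, $S$ is a span $A_0 \xleftarrow{L} S_0 \xrightarrow{R} B_0$ with a left action $\lambda_S\colon A_1\times_{A_0}S_0\to S_0$ (defined on pairs $(\alpha,s)$ with $d\alpha=Ls$) and a right action $\rho_S\colon S_0\times_{B_0}B_1\to S_0$ (defined on pairs $(s,\beta)$ with $Rs=c\beta$) which are associative, unital and compatible; similarly for $T$. Write $\mathbb S$ for the internal groupoid with object of objects $S_0$ and object of arrows $S_1$ the pullback of $\lambda_S$ and $\rho_S$ (so that an arrow $s\to s'$ is a pair $(\alpha,\beta)$ with $\alpha\cdot s=s'\cdot\beta$), with its projection functors $L\colon\mathbb S\to\mathbb A$ and $R\colon\mathbb S\to\mathbb B$; similarly for $\mathbb T$. Let $T\diamond S=\mathbb S\times_{\mathbb B}\mathbb T$ be the composite span (the levelwise pullback), with projections $\bar L\colon T\diamond S\to \mathbb S$ and $\bar R\colon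 T\diamond S\to\mathbb T$. Let $T\otimes S$ be the composite distributor: its object $(T\otimes S)_0$ is the coequalizer $Q_0\colon S_0\times_{B_0}T_0\to (T\otimes S)_0$ of $\rho_S\times \mathrm{id}$ and $\mathrm{id}\times\lambda_T\colon S_0\times_{B_0}B_1\times_{B_0}T_0\rightrightarrows S_0\times_{B_0}T_0$, with the legs to $A_0$ and $C_0$ and the actions of $\mathbb A$ and $\mathbb C$ induced from those of $S$ and $T$. Write $\mathbb{P}$ for the internal groupoid associated with the distributor $T\otimes S$ in the same way, and $P\colon\mathbb{P}\to\mathbb A\times\mathbb C$ for the functor given by its two projections. An internal functor $F\colon \mathbb X\to\mathbb Y$ is a discrete fibration if the square $c\cdot F_1=F_0\cdot c$ is a pullback, and final if it is left orthogonal to all discrete fibrations between internal groupoids in $\mathcal E$. It is internally full if the canonical comparison from $X_1$ to the joint pullback of $d,c\colon Y_1\rightrightarrows Y_0$ along $F_0$ is a regular epimorphism, and internally essentially surjective if $\Pi_0(F)$ is an isomorphism, where $\Pi_0(\mathbb X)$ is the coequalizer of $d,c\colon X_1\rightrightarrows X_0$. Then the factorization of $\langle L\bar L,R\bar R\rangle\colon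 T\diamond S\to\mathbb A\times\mathbb C$ through $P$ is its comprehensive factorization. More precisely: 1. There is exactly one internal functor $Q=(Q_0,Q_1)\colon T\diamond S\to\mathbb{P}$ whose component on objects is the coequalizer $Q_0$ and for which $P\cdot Q=\langle L\bar L,R\bar R\rangle$. 2. $Q$ is internally full and internally essentially surjective, and it is final; $P$ is a discrete fibration. 3. If $\langle L\bar L,R\bar R\rangle=G\cdot F$ with $F\colon T\diamond S\to\mathbb Z$ final and $G\colon\mathbb Z\to\mathbb A\times\mathbb C$ a discrete fibration, where $\mathbb Z$ is an internal groupoid in $\mathcal E$, then there is exactly one isomorphism $i\colon\mathbb Z\to\mathbb{P}$ with $i\cdot F=Q$ and $P\cdot i=G$. -/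

import Mathlib

open CategoryTheory Limits

universe v u

namespace InternalGpd

/-- A Barr-exact category: a regular category (finite limits, coequalizers of kernel pairs,
pullback-stable regular epimorphisms) in which every internal equivalence relation is effective. -/
class BarrExact (E : Type u) [Category.{v} E] : Prop extends Regular E where
  effective : ∀ {R X : E} (p₁ p₂ : R ⟶ X), IsEquivalenceRelation p₁ p₂ →
    IsEffectiveEquivalenceRelation p₁ p₂

/-! ### Internal groupoids and internal functors -/

section Groupoids

attribute [local simp] pullback.lift_fst pullback.lift_snd pullback.lift_fst_assoc
  pullback.lift_snd_assoc prod.lift_fst prod.lift_snd prod.lift_fst_assoc prod.lift_snd_assoc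

/-- An internal groupoid. `m` is composition in diagrammatic order, defined on the object of
composable pairs `(f, g)` with `c f = d g`; `τ` is inversion. Associativity is stated on
generalized elements. -/
structure IntGpd (E : Type u) [Category.{v} E] [HasFiniteLimits E] where
  C₀ : E
  C₁ : E
  d : C₁ ⟶ C₀
  c : C₁ ⟶ C₀
  e : C₀ ⟶ C₁
  m : pullback c d ⟶ C₁
  τ : C₁ ⟶ C₁
  e_d : e ≫ d = 𝟙 C₀
  e_c : e ≫ c = 𝟙 C₀
  m_d : m ≫ d = pullback.fst c d ≫ d
  m_c : m ≫ c = pullback.snd c d ≫ c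
  id_m : pullback.lift (d ≫ e) (𝟙 C₁) (by rw [Category.assoc, e_c, Category.comp_id,
    Category.id_comp]) ≫ m = 𝟙 C₁
  m_id : pullback.lift (𝟙 C₁) (c ≫ e) (by rw [Category.assoc, e_d, Category.comp_id,
    Category.id_comp]) ≫ m = 𝟙 C₁
  m_assoc : ∀ {X : E} (f g h : X ⟶ C₁) (hfg : f ≫ c = g ≫ d) (hgh : g ≫ c = h ≫ d),
    pullback.lift (pullback.lift f g hfg ≫ m) h
      (by rw [Category.assoc, m_c, pullback.lift_snd_assoc, hgh]) ≫ m =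
    pullback.lift f (pullback.lift g h hgh ≫ m)
      (by rw [Category.assoc, m_d, pullback.lift_fst_assoc, hfg]) ≫ m
  τ_d : τ ≫ d = c
  τ_c : τ ≫ c = d
  m_τ : pullback.lift (𝟙 C₁) τ (by rw [τ_d, Category.id_comp]) ≫ m = d ≫ e
  τ_m : pullback.lift τ (𝟙 C₁) (by rw [τ_c, Category.id_comp]) ≫ m = c ≫ e

variable {E : Type u} [Category.{v} E] [HasFiniteLimits E]

namespace IntGpd

variable (G : IntGpd E) {X Y : E}

/-- Composition of composable generalized elements of the object of arrows. -/
noncomputable def comp (f g : X ⟶ G.C₁) (h : f ≫ G.c = g ≫ G.d) : X ⟶ G.C₁ :=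
  pullback.lift f g h ≫ G.m

variable {G}

lemma comp_d (f g : X ⟶ G.C₁) (h : f ≫ G.c = g ≫ G.d) : G.comp f g h ≫ G.d = f ≫ G.d := by
  simp [comp, G.m_d]

lemma comp_c (f g : X ⟶ G.C₁) (h : f ≫ G.c = g ≫ G.d) : G.comp f g h ≫ G.c = g ≫ G.c := by
  simp [comp, G.m_c]

lemma comp_congr {f f' g g' : X ⟶ G.C₁} (h : f ≫ G.c = g ≫ G.d) (hf : f = f') (hg : g = g') :
    G.comp f g h = G.comp f' g' (by rw [← hf, ← hg, h]) := by
  subst hf hg; rfl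

lemma precomp (k : Y ⟶ X) (f g : X ⟶ G.C₁) (h : f ≫ G.c = g ≫ G.d) :
    k ≫ G.comp f g h = G.comp (k ≫ f) (k ≫ g) (by simp [h]) := by
  rw [comp, comp, ← Category.assoc]
  congr 1
  ext <;> simp

lemma id_comp (f : X ⟶ G.C₁) (x : X ⟶ G.C₀) (hx : f ≫ G.d = x) :
    G.comp (x ≫ G.e) f (by simp [G.e_c, hx]) = f := by
  subst hx
  refine Eq.trans ?_ ((congrArg (fun t => f ≫ t) G.id_m).trans (Category.comp_id f))
  refine Eq.trans ?_ (Category.assoc _ _ _)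
  rw [comp]
  congr 1
  ext <;> simp

lemma comp_id (f : X ⟶ G.C₁) (x : X ⟶ G.C₀) (hx : f ≫ G.c = x) :
    G.comp f (x ≫ G.e) (by simp [G.e_d, hx]) = f := by
  subst hx
  refine Eq.trans ?_ ((congrArg (fun t => f ≫ t) G.m_id).trans (Category.comp_id f))
  refine Eq.trans ?_ (Category.assoc _ _ _)
  rw [comp]
  congr 1
  ext <;> simp

lemma assoc (f g h : X ⟶ G.C₁) (hfg : f ≫ G.c = g ≫ G.d) (hgh : g ≫ G.c = h ≫ G.d) :
    G.comp (G.comp f g hfg) h (by rw [comp_c, hgh]) =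
      G.comp f (G.comp g h hgh) (by rw [comp_d, hfg]) :=
  G.m_assoc f g h hfg hgh

lemma comp_inv (f : X ⟶ G.C₁) :
    G.comp f (f ≫ G.τ) (by simp [G.τ_d]) = f ≫ G.d ≫ G.e := by
  refine Eq.trans ?_ (congrArg (fun t => f ≫ t) G.m_τ)
  refine Eq.trans ?_ (Category.assoc _ _ _)
  rw [comp]
  congr 1
  ext <;> simp

lemma inv_comp (f : X ⟶ G.C₁) :
    G.comp (f ≫ G.τ) f (by simp [G.τ_c]) = f ≫ G.c ≫ G.e := by
  refine Eq.trans ?_ (congrArg (fun t => f ≫ t) G.τ_m)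
  refine Eq.trans ?_ (Category.assoc _ _ _)
  rw [comp]
  congr 1
  ext <;> simp

end IntGpd

/-- An internal functor; preservation of composition is stated on the object of composable pairs. -/
@[ext]
structure IntFunctor (G H : IntGpd E) where
  F₀ : G.C₀ ⟶ H.C₀
  F₁ : G.C₁ ⟶ H.C₁
  map_d : F₁ ≫ H.d = G.d ≫ F₀
  map_c : F₁ ≫ H.c = G.c ≫ F₀
  map_e : G.e ≫ F₁ = F₀ ≫ H.e
  map_m : G.m ≫ F₁ = H.comp (pullback.fst G.c G.d ≫ F₁) (pullback.snd G.c G.d ≫ F₁)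
    (by rw [Category.assoc, Category.assoc, map_c, map_d, pullback.condition_assoc])

lemma IntFunctor.map_comp {G H : IntGpd E} (F : IntFunctor G H) {X : E} (f g : X ⟶ G.C₁)
    (h : f ≫ G.c = g ≫ G.d) :
    G.comp f g h ≫ F.F₁ = H.comp (f ≫ F.F₁) (g ≫ F.F₁)
      (by rw [Category.assoc, Category.assoc, F.map_c, F.map_d, reassoc_of% h]) := by
  rw [IntGpd.comp, Category.assoc, F.map_m, IntGpd.precomp]
  apply IntGpd.comp_congr <;> simp

lemma IntFunctor.map_τ {G H : IntGpd E} (F : IntFunctor G H) : G.τ ≫ F.F₁ = F.F₁ ≫ H.τ := by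
  have h₁ : (G.τ ≫ F.F₁) ≫ H.c = F.F₁ ≫ H.d := by
    simp [F.map_c, F.map_d, reassoc_of% G.τ_c]
  have h₂ : F.F₁ ≫ H.c = (F.F₁ ≫ H.τ) ≫ H.d := by simp [H.τ_d]
  have h₃ : H.comp (G.τ ≫ F.F₁) F.F₁ h₁ = G.c ≫ F.F₀ ≫ H.e := by
    rw [← F.map_e, ← Category.assoc G.c, ← G.τ_m]
    refine Eq.trans ?_ (F.map_comp G.τ (𝟙 _) (by simp [G.τ_c])).symm
    apply IntGpd.comp_congr <;> simp
  have h₄ := IntGpd.assoc (G.τ ≫ F.F₁) F.F₁ (F.F₁ ≫ H.τ) h₁ h₂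
  rw [IntGpd.comp_congr _ rfl (IntGpd.comp_inv F.F₁), IntGpd.comp_congr _ h₃ rfl] at h₄
  have h₅ := IntGpd.comp_id (G.τ ≫ F.F₁) (F.F₁ ≫ H.d) h₁
  have h₆ := IntGpd.id_comp (F.F₁ ≫ H.τ) (G.c ≫ F.F₀) (by simp [H.τ_d, F.map_c])
  simp only [Category.assoc] at h₄ h₅ h₆
  exact h₅.symm.trans (h₄.symm.trans h₆)

/-- The category of internal groupoids and internal functors. -/
instance : Category (IntGpd E) where
  Hom G H := IntFunctor G H
  id G :=
    { F₀ := 𝟙 _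
      F₁ := 𝟙 _
      map_d := by simp
      map_c := by simp
      map_e := by simp
      map_m := by
        rw [IntGpd.comp, Category.comp_id]
        refine (Category.id_comp G.m).symm.trans ?_
        congr 1
        ext <;> simp }
  comp F K :=
    { F₀ := F.F₀ ≫ K.F₀
      F₁ := F.F₁ ≫ K.F₁
      map_d := by simp [K.map_d, reassoc_of% F.map_d]
      map_c := by simp [K.map_c, reassoc_of% F.map_c]
      map_e := by simp [← K.map_e, reassoc_of% F.map_e]
      map_m := by
        rw [← Category.assoc, F.map_m, IntFunctor.map_comp]
        apply IntGpd.comp_congr <;> simp }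
  id_comp F := by apply IntFunctor.ext <;> apply Category.id_comp
  comp_id F := by apply IntFunctor.ext <;> apply Category.comp_id
  assoc F G H := by apply IntFunctor.ext <;> apply Category.assoc

@[ext]
lemma IntFunctor.hom_ext {G H : IntGpd E} {F K : G ⟶ H} (h₀ : F.F₀ = K.F₀) (h₁ : F.F₁ = K.F₁) :
    F = K :=
  IntFunctor.ext h₀ h₁

@[simp]
lemma IntFunctor.comp_F₀ {G H K : IntGpd E} (F : G ⟶ H) (F' : H ⟶ K) :
    (F ≫ F').F₀ = F.F₀ ≫ F'.F₀ := rfl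

@[simp]
lemma IntFunctor.comp_F₁ {G H K : IntGpd E} (F : G ⟶ H) (F' : H ⟶ K) :
    (F ≫ F').F₁ = F.F₁ ≫ F'.F₁ := rfl

/-- The product of two internal groupoids, computed levelwise. -/
noncomputable def IntGpd.prod (G H : IntGpd E) : IntGpd E where
  C₀ := G.C₀ ⨯ H.C₀
  C₁ := G.C₁ ⨯ H.C₁
  d := prod.map G.d H.d
  c := prod.map G.c H.c
  e := prod.map G.e H.e
  τ := prod.map G.τ H.τ
  m := prod.lift
    (G.comp (pullback.fst _ _ ≫ prod.fst) (pullback.snd _ _ ≫ prod.fst) (by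
      have := congrArg (fun t => t ≫ prod.fst)
        (pullback.condition (f := prod.map G.c H.c) (g := prod.map G.d H.d))
      simpa using this))
    (H.comp (pullback.fst _ _ ≫ prod.snd) (pullback.snd _ _ ≫ prod.snd) (by
      have := congrArg (fun t => t ≫ prod.snd)
        (pullback.condition (f := prod.map G.c H.c) (g := prod.map G.d H.d))
      simpa using this))
  e_d := by simp [G.e_d, H.e_d]
  e_c := by simp [G.e_c, H.e_c]
  m_d := by ext <;> simp [IntGpd.comp_d]
  m_c := by ext <;> simp [IntGpd.comp_c]
  id_m := by
    ext
    · simp only [Category.assoc, prod.lift_fst, IntGpd.precomp, Category.id_comp]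
      refine (IntGpd.comp_congr _ ?_ ?_).trans (IntGpd.id_comp _ _ rfl) <;> simp
    · simp only [Category.assoc, prod.lift_snd, IntGpd.precomp, Category.id_comp]
      refine (IntGpd.comp_congr _ ?_ ?_).trans (IntGpd.id_comp _ _ rfl) <;> simp
  m_id := by
    ext
    · simp only [Category.assoc, prod.lift_fst, IntGpd.precomp, Category.id_comp]
      refine (IntGpd.comp_congr _ ?_ ?_).trans (IntGpd.comp_id _ _ rfl) <;> simp
    · simp only [Category.assoc, prod.lift_snd, IntGpd.precomp, Category.id_comp]
      refine (IntGpd.comp_congr _ ?_ ?_).trans (IntGpd.comp_id _ _ rfl) <;> simp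
  m_assoc f g h hfg hgh := by
    have a₁ := congrArg (fun t => t ≫ prod.fst) hfg
    have a₂ := congrArg (fun t => t ≫ prod.fst) hgh
    have b₁ := congrArg (fun t => t ≫ prod.snd) hfg
    have b₂ := congrArg (fun t => t ≫ prod.snd) hgh
    ext
    · simp only [Category.assoc, prod.lift_fst, IntGpd.precomp, pullback.lift_fst_assoc,
        pullback.lift_snd_assoc]
      exact IntGpd.assoc _ _ _ (by simpa using a₁) (by simpa using a₂)
    · simp only [Category.assoc, prod.lift_snd, IntGpd.precomp, pullback.lift_fst_assoc,
        pullback.lift_snd_assoc]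
      exact IntGpd.assoc _ _ _ (by simpa using b₁) (by simpa using b₂)
  τ_d := by simp [G.τ_d, H.τ_d]
  τ_c := by simp [G.τ_c, H.τ_c]
  m_τ := by
    ext
    · simp only [Category.assoc, prod.lift_fst, IntGpd.precomp]
      refine (IntGpd.comp_congr _ ?_ ?_).trans ((IntGpd.comp_inv prod.fst).trans ?_) <;> simp
    · simp only [Category.assoc, prod.lift_snd, IntGpd.precomp]
      refine (IntGpd.comp_congr _ ?_ ?_).trans ((IntGpd.comp_inv prod.snd).trans ?_) <;> simp
  τ_m := by
    ext
    · simp only [Category.assoc, prod.lift_fst, IntGpd.precomp]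
      refine (IntGpd.comp_congr _ ?_ ?_).trans ((IntGpd.inv_comp prod.fst).trans ?_) <;> simp
    · simp only [Category.assoc, prod.lift_snd, IntGpd.precomp]
      refine (IntGpd.comp_congr _ ?_ ?_).trans ((IntGpd.inv_comp prod.snd).trans ?_) <;> simp

/-- The functor `⟨F, K⟩` into a product of internal groupoids. -/
noncomputable def IntGpd.pair {G H Z : IntGpd E} (F : Z ⟶ G) (K : Z ⟶ H) : Z ⟶ G.prod H where
  F₀ := prod.lift F.F₀ K.F₀
  F₁ := prod.lift F.F₁ K.F₁
  map_d := by dsimp [IntGpd.prod]; ext <;> simp [F.map_d, K.map_d]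
  map_c := by dsimp [IntGpd.prod]; ext <;> simp [F.map_c, K.map_c]
  map_e := by dsimp [IntGpd.prod]; ext <;> simp [F.map_e, K.map_e]
  map_m := by
    dsimp only [IntGpd.prod, IntGpd.comp]
    ext
    · simp only [Category.assoc, prod.lift_fst, F.map_m]
      refine Eq.trans ?_ (IntGpd.precomp _ _ _ _).symm
      apply IntGpd.comp_congr <;> simp
    · simp only [Category.assoc, prod.lift_snd, K.map_m]
      refine Eq.trans ?_ (IntGpd.precomp _ _ _ _).symm
      apply IntGpd.comp_congr <;> simp

lemma IntGpd.pb_aux₁ {G H K : IntGpd E} (F : G ⟶ K) (F' : H ⟶ K) {X : E}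
    {f g : X ⟶ pullback F.F₁ F'.F₁} {a b : pullback F.F₁ F'.F₁ ⟶ H.C₀}
    {h₁ : (pullback.fst F.F₁ F'.F₁ ≫ G.c) ≫ F.F₀ = a ≫ F'.F₀}
    {h₂ : (pullback.fst F.F₁ F'.F₁ ≫ G.d) ≫ F.F₀ = b ≫ F'.F₀}
    (h : f ≫ pullback.lift (pullback.fst F.F₁ F'.F₁ ≫ G.c) a h₁ =
      g ≫ pullback.lift (pullback.fst F.F₁ F'.F₁ ≫ G.d) b h₂) :
    (f ≫ pullback.fst F.F₁ F'.F₁) ≫ G.c = (g ≫ pullback.fst F.F₁ F'.F₁) ≫ G.d := by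
  have := congrArg (fun t => t ≫ pullback.fst F.F₀ F'.F₀) h
  simpa using this

lemma IntGpd.pb_aux₂ {G H K : IntGpd E} (F : G ⟶ K) (F' : H ⟶ K) {X : E}
    {f g : X ⟶ pullback F.F₁ F'.F₁} {a b : pullback F.F₁ F'.F₁ ⟶ G.C₀}
    {h₁ : a ≫ F.F₀ = (pullback.snd F.F₁ F'.F₁ ≫ H.c) ≫ F'.F₀}
    {h₂ : b ≫ F.F₀ = (pullback.snd F.F₁ F'.F₁ ≫ H.d) ≫ F'.F₀}
    (h : f ≫ pullback.lift a (pullback.snd F.F₁ F'.F₁ ≫ H.c) h₁ =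
      g ≫ pullback.lift b (pullback.snd F.F₁ F'.F₁ ≫ H.d) h₂) :
    (f ≫ pullback.snd F.F₁ F'.F₁) ≫ H.c = (g ≫ pullback.snd F.F₁ F'.F₁) ≫ H.d := by
  have := congrArg (fun t => t ≫ pullback.snd F.F₀ F'.F₀) h
  simpa using this

/-- The pullback of internal groupoids along two internal functors, computed levelwise. -/
noncomputable def IntGpd.pb {G H K : IntGpd E} (F : G ⟶ K) (F' : H ⟶ K) : IntGpd E where
  C₀ := pullback F.F₀ F'.F₀
  C₁ := pullback F.F₁ F'.F₁
  d := pullback.lift (pullback.fst _ _ ≫ G.d) (pullback.snd _ _ ≫ H.d) (by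
    simp only [Category.assoc, ← F.map_d, ← F'.map_d, pullback.condition_assoc])
  c := pullback.lift (pullback.fst _ _ ≫ G.c) (pullback.snd _ _ ≫ H.c) (by
    simp only [Category.assoc, ← F.map_c, ← F'.map_c, pullback.condition_assoc])
  e := pullback.lift (pullback.fst _ _ ≫ G.e) (pullback.snd _ _ ≫ H.e) (by
    simp only [Category.assoc, F.map_e, F'.map_e, pullback.condition_assoc])
  τ := pullback.lift (pullback.fst _ _ ≫ G.τ) (pullback.snd _ _ ≫ H.τ) (by
    simp only [Category.assoc, F.map_τ, F'.map_τ, pullback.condition_assoc])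
  m := pullback.lift
    (G.comp (pullback.fst _ _ ≫ pullback.fst _ _) (pullback.snd _ _ ≫ pullback.fst _ _)
      (IntGpd.pb_aux₁ F F' (pullback.condition)))
    (H.comp (pullback.fst _ _ ≫ pullback.snd _ _) (pullback.snd _ _ ≫ pullback.snd _ _)
      (IntGpd.pb_aux₂ F F' (pullback.condition)))
    (by
      rw [F.map_comp, F'.map_comp]
      apply IntGpd.comp_congr <;> simp only [Category.assoc, pullback.condition])
  e_d := by ext <;> simp [G.e_d, H.e_d]
  e_c := by ext <;> simp [G.e_c, H.e_c]
  m_d := by ext <;> simp [IntGpd.comp_d]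
  m_c := by ext <;> simp [IntGpd.comp_c]
  id_m := by
    ext
    · simp only [Category.assoc, pullback.lift_fst, IntGpd.precomp, Category.id_comp]
      refine (IntGpd.comp_congr _ ?_ ?_).trans (IntGpd.id_comp _ _ rfl) <;> simp
    · simp only [Category.assoc, pullback.lift_snd, IntGpd.precomp, Category.id_comp]
      refine (IntGpd.comp_congr _ ?_ ?_).trans (IntGpd.id_comp _ _ rfl) <;> simp
  m_id := by
    ext
    · simp only [Category.assoc, pullback.lift_fst, IntGpd.precomp, Category.id_comp]
      refine (IntGpd.comp_congr _ ?_ ?_).trans (IntGpd.comp_id _ _ rfl) <;> simp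
    · simp only [Category.assoc, pullback.lift_snd, IntGpd.precomp, Category.id_comp]
      refine (IntGpd.comp_congr _ ?_ ?_).trans (IntGpd.comp_id _ _ rfl) <;> simp
  m_assoc f g h hfg hgh := by
    ext
    · simp only [Category.assoc, pullback.lift_fst, IntGpd.precomp, pullback.lift_fst_assoc,
        pullback.lift_snd_assoc]
      exact IntGpd.assoc _ _ _ (IntGpd.pb_aux₁ F F' hfg) (IntGpd.pb_aux₁ F F' hgh)
    · simp only [Category.assoc, pullback.lift_snd, IntGpd.precomp, pullback.lift_fst_assoc,
        pullback.lift_snd_assoc]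
      exact IntGpd.assoc _ _ _ (IntGpd.pb_aux₂ F F' hfg) (IntGpd.pb_aux₂ F F' hgh)
  τ_d := by ext <;> simp [G.τ_d, H.τ_d]
  τ_c := by ext <;> simp [G.τ_c, H.τ_c]
  m_τ := by
    ext
    · simp only [Category.assoc, pullback.lift_fst, IntGpd.precomp]
      refine (IntGpd.comp_congr _ ?_ ?_).trans ((IntGpd.comp_inv (pullback.fst _ _)).trans ?_) <;>
        simp
    · simp only [Category.assoc, pullback.lift_snd, IntGpd.precomp]
      refine (IntGpd.comp_congr _ ?_ ?_).trans ((IntGpd.comp_inv (pullback.snd _ _)).trans ?_) <;>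
        simp
  τ_m := by
    ext
    · simp only [Category.assoc, pullback.lift_fst, IntGpd.precomp]
      refine (IntGpd.comp_congr _ ?_ ?_).trans ((IntGpd.inv_comp (pullback.fst _ _)).trans ?_) <;>
        simp
    · simp only [Category.assoc, pullback.lift_snd, IntGpd.precomp]
      refine (IntGpd.comp_congr _ ?_ ?_).trans ((IntGpd.inv_comp (pullback.snd _ _)).trans ?_) <;>
        simp

/-- The first projection of the pullback of internal groupoids. -/
noncomputable def IntGpd.pbFst {G H K : IntGpd E} (F : G ⟶ K) (F' : H ⟶ K) :
    IntGpd.pb F F' ⟶ G where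
  F₀ := pullback.fst _ _
  F₁ := pullback.fst _ _
  map_d := by simp [IntGpd.pb]
  map_c := by simp [IntGpd.pb]
  map_e := by simp [IntGpd.pb]
  map_m := by dsimp only [IntGpd.pb]; rw [pullback.lift_fst]

/-- The second projection of the pullback of internal groupoids. -/
noncomputable def IntGpd.pbSnd {G H K : IntGpd E} (F : G ⟶ K) (F' : H ⟶ K) :
    IntGpd.pb F F' ⟶ H where
  F₀ := pullback.snd _ _
  F₁ := pullback.snd _ _
  map_d := by simp [IntGpd.pb]
  map_c := by simp [IntGpd.pb]
  map_e := by simp [IntGpd.pb]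
  map_m := by dsimp only [IntGpd.pb]; rw [pullback.lift_snd]

/-- `F` is a discrete fibration when the square `c ∘ F₁ = F₀ ∘ c` is a pullback. -/
def IsDiscreteFibration {G H : IntGpd E} (F : G ⟶ H) : Prop :=
  IsPullback F.F₁ G.c H.c F.F₀

/-- `F` is final when it is left orthogonal to every discrete fibration: each commutative square
from `F` to a discrete fibration has exactly one diagonal filler. -/
def IsFinal {G H : IntGpd E} (F : G ⟶ H) : Prop :=
  ∀ ⦃X Y : IntGpd E⦄ (p : X ⟶ Y), IsDiscreteFibration p →
    ∀ (u : G ⟶ X) (v : H ⟶ Y), u ≫ p = F ≫ v → ∃! w : H ⟶ X, F ≫ w = u ∧ w ≫ p = v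

/-- The canonical comparison of `G₁` with the joint pullback of `d` and `c` along `F₀`. -/
noncomputable def fullComparison {G H : IntGpd E} (F : G ⟶ H) :
    G.C₁ ⟶ pullback (prod.map F.F₀ F.F₀) (prod.lift H.d H.c) :=
  pullback.lift (prod.lift G.d G.c) F.F₁ (by ext <;> simp [F.map_d, F.map_c])

/-- `F` is internally full. -/
def IsFull {G H : IntGpd E} (F : G ⟶ H) : Prop := IsRegularEpi (fullComparison F)

/-! ### Internal distributors and their spans -/

/-- An internal distributor from `A` to `B`. The left action is defined on pairs `(α, s)` with
`d α = L s`, the right action on pairs `(s, β)` with `R s = c β`; in sets one writes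
`α · s` and `s · β`, where `s : b ⇢ a`, `α : a ⟶ a'`, `β : b' ⟶ b`.
The associativity and compatibility axioms are stated on generalized elements. -/
structure Distributor (A B : IntGpd E) where
  S₀ : E
  L : S₀ ⟶ A.C₀
  R : S₀ ⟶ B.C₀
  lam : pullback A.d L ⟶ S₀
  rho : pullback R B.c ⟶ S₀
  lam_L : lam ≫ L = pullback.fst A.d L ≫ A.c
  lam_R : lam ≫ R = pullback.snd A.d L ≫ R
  rho_L : rho ≫ L = pullback.fst R B.c ≫ L
  rho_R : rho ≫ R = pullback.snd R B.c ≫ B.d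
  lam_unit : pullback.lift (L ≫ A.e) (𝟙 S₀)
    (by rw [Category.assoc, A.e_d, Category.comp_id, Category.id_comp]) ≫ lam = 𝟙 S₀
  rho_unit : pullback.lift (𝟙 S₀) (R ≫ B.e)
    (by rw [Category.assoc, B.e_c, Category.comp_id, Category.id_comp]) ≫ rho = 𝟙 S₀
  lam_assoc : ∀ {X : E} (α α' : X ⟶ A.C₁) (s : X ⟶ S₀) (h : α ≫ A.c = α' ≫ A.d)
    (hs : α ≫ A.d = s ≫ L),
    pullback.lift (A.comp α α' h) s (by rw [IntGpd.comp_d, hs]) ≫ lam =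
      pullback.lift α' (pullback.lift α s hs ≫ lam)
        (by rw [Category.assoc, lam_L, pullback.lift_fst_assoc, h]) ≫ lam
  rho_assoc : ∀ {X : E} (s : X ⟶ S₀) (β' β : X ⟶ B.C₁) (h : β' ≫ B.c = β ≫ B.d)
    (hs : s ≫ R = β ≫ B.c),
    pullback.lift s (B.comp β' β h) (by rw [IntGpd.comp_c, hs]) ≫ rho =
      pullback.lift (pullback.lift s β hs ≫ rho) β'
        (by rw [Category.assoc, rho_R, pullback.lift_snd_assoc, h]) ≫ rho
  compat : ∀ {X : E} (α : X ⟶ A.C₁) (s : X ⟶ S₀) (β : X ⟶ B.C₁) (h : α ≫ A.d = s ≫ L)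
    (h' : s ≫ R = β ≫ B.c),
    pullback.lift (pullback.lift α s h ≫ lam) β
        (by rw [Category.assoc, lam_R, pullback.lift_snd_assoc, h']) ≫ rho =
      pullback.lift α (pullback.lift s β h' ≫ rho)
        (by rw [Category.assoc, rho_L, pullback.lift_fst_assoc, h]) ≫ lam

namespace Distributor

variable {A B C : IntGpd E} (S : Distributor A B) {X Y : E}

/-- The left action `α · s` on generalized elements. -/
noncomputable def la (α : X ⟶ A.C₁) (s : X ⟶ S.S₀) (h : α ≫ A.d = s ≫ S.L) : X ⟶ S.S₀ :=
  pullback.lift α s h ≫ S.lam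

/-- The right action `s · β` on generalized elements. -/
noncomputable def ra (s : X ⟶ S.S₀) (β : X ⟶ B.C₁) (h : s ≫ S.R = β ≫ B.c) : X ⟶ S.S₀ :=
  pullback.lift s β h ≫ S.rho

variable {S}

lemma la_L (α : X ⟶ A.C₁) (s : X ⟶ S.S₀) (h : α ≫ A.d = s ≫ S.L) :
    S.la α s h ≫ S.L = α ≫ A.c := by simp [la, S.lam_L]

lemma la_R (α : X ⟶ A.C₁) (s : X ⟶ S.S₀) (h : α ≫ A.d = s ≫ S.L) :
    S.la α s h ≫ S.R = s ≫ S.R := by simp [la, S.lam_R]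

lemma ra_L (s : X ⟶ S.S₀) (β : X ⟶ B.C₁) (h : s ≫ S.R = β ≫ B.c) :
    S.ra s β h ≫ S.L = s ≫ S.L := by simp [ra, S.rho_L]

lemma ra_R (s : X ⟶ S.S₀) (β : X ⟶ B.C₁) (h : s ≫ S.R = β ≫ B.c) :
    S.ra s β h ≫ S.R = β ≫ B.d := by simp [ra, S.rho_R]

lemma la_congr {α α' : X ⟶ A.C₁} {s s' : X ⟶ S.S₀} (h : α ≫ A.d = s ≫ S.L) (hα : α = α')
    (hs : s = s') : S.la α s h = S.la α' s' (by rw [← hα, ← hs, h]) := by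
  subst hα hs; rfl

lemma ra_congr {β β' : X ⟶ B.C₁} {s s' : X ⟶ S.S₀} (h : s ≫ S.R = β ≫ B.c) (hs : s = s')
    (hβ : β = β') : S.ra s β h = S.ra s' β' (by rw [← hβ, ← hs, h]) := by
  subst hβ hs; rfl

lemma precomp_la (k : Y ⟶ X) (α : X ⟶ A.C₁) (s : X ⟶ S.S₀) (h : α ≫ A.d = s ≫ S.L) :
    k ≫ S.la α s h = S.la (k ≫ α) (k ≫ s) (by simp [h]) := by
  rw [la, la, ← Category.assoc]
  congr 1
  ext <;> simp

lemma precomp_ra (k : Y ⟶ X) (s : X ⟶ S.S₀) (β : X ⟶ B.C₁) (h : s ≫ S.R = β ≫ B.c) :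
    k ≫ S.ra s β h = S.ra (k ≫ s) (k ≫ β) (by simp [h]) := by
  rw [ra, ra, ← Category.assoc]
  congr 1
  ext <;> simp

lemma la_unit (s : X ⟶ S.S₀) (x : X ⟶ A.C₀) (h : s ≫ S.L = x) :
    S.la (x ≫ A.e) s (by simp [A.e_d, h]) = s := by
  subst h
  refine Eq.trans ?_ ((congrArg (fun t => s ≫ t) S.lam_unit).trans (Category.comp_id s))
  refine Eq.trans ?_ (Category.assoc _ _ _)
  rw [la]
  congr 1
  ext <;> simp

lemma ra_unit (s : X ⟶ S.S₀) (x : X ⟶ B.C₀) (h : s ≫ S.R = x) :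
    S.ra s (x ≫ B.e) (by simp [B.e_c, h]) = s := by
  subst h
  refine Eq.trans ?_ ((congrArg (fun t => s ≫ t) S.rho_unit).trans (Category.comp_id s))
  refine Eq.trans ?_ (Category.assoc _ _ _)
  rw [ra]
  congr 1
  ext <;> simp

lemma la_la (α α' : X ⟶ A.C₁) (s : X ⟶ S.S₀) (h : α ≫ A.c = α' ≫ A.d)
    (hs : α ≫ A.d = s ≫ S.L) :
    S.la (A.comp α α' h) s (by rw [IntGpd.comp_d, hs]) =
      S.la α' (S.la α s hs) (by rw [la_L, h]) := S.lam_assoc α α' s h hs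

lemma ra_ra (s : X ⟶ S.S₀) (β' β : X ⟶ B.C₁) (h : β' ≫ B.c = β ≫ B.d)
    (hs : s ≫ S.R = β ≫ B.c) :
    S.ra s (B.comp β' β h) (by rw [IntGpd.comp_c, hs]) =
      S.ra (S.ra s β hs) β' (by rw [ra_R, h]) := S.rho_assoc s β' β h hs

lemma la_ra (α : X ⟶ A.C₁) (s : X ⟶ S.S₀) (β : X ⟶ B.C₁) (h : α ≫ A.d = s ≫ S.L)
    (h' : s ≫ S.R = β ≫ B.c) :
    S.ra (S.la α s h) β (by rw [la_R, h']) = S.la α (S.ra s β h') (by rw [ra_L, h]) :=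
  S.compat α s β h h'

variable (S)

/-- The object `S₁` of commutative squares `α · s = s' · β`. -/
noncomputable abbrev Sq : E := pullback S.lam S.rho

/-- The component `α` of a square. -/
noncomputable def sqα : S.Sq ⟶ A.C₁ := pullback.fst S.lam S.rho ≫ pullback.fst A.d S.L

/-- The component `s` of a square. -/
noncomputable def sqs : S.Sq ⟶ S.S₀ := pullback.fst S.lam S.rho ≫ pullback.snd A.d S.L

/-- The component `s'` of a square. -/
noncomputable def sqs' : S.Sq ⟶ S.S₀ := pullback.snd S.lam S.rho ≫ pullback.fst S.R B.c

/-- The component `β` of a square. -/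
noncomputable def sqβ : S.Sq ⟶ B.C₁ := pullback.snd S.lam S.rho ≫ pullback.snd S.R B.c

lemma sqα_d : S.sqα ≫ A.d = S.sqs ≫ S.L := by
  simp [sqα, sqs, pullback.condition]

lemma sqβ_c : S.sqs' ≫ S.R = S.sqβ ≫ B.c := by
  simp [sqβ, sqs', pullback.condition]

lemma sq_comm : S.la S.sqα S.sqs S.sqα_d = S.ra S.sqs' S.sqβ S.sqβ_c := by
  refine Eq.trans ?_ ((pullback.condition (f := S.lam) (g := S.rho)).trans ?_)
  · rw [la]; congr 1; ext <;> simp [sqα, sqs]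
  · rw [ra]; congr 1; ext <;> simp [sqβ, sqs']

lemma sqα_c : S.sqα ≫ A.c = S.sqs' ≫ S.L := by
  rw [← la_L _ _ S.sqα_d, sq_comm, ra_L]

lemma sqβ_d : S.sqβ ≫ B.d = S.sqs ≫ S.R := by
  rw [← ra_R _ _ S.sqβ_c, ← sq_comm, la_R]

/-- The generalized element of `S₁` with given components. -/
noncomputable def sqMk (α : X ⟶ A.C₁) (s s' : X ⟶ S.S₀) (β : X ⟶ B.C₁) (h : α ≫ A.d = s ≫ S.L)
    (h' : s' ≫ S.R = β ≫ B.c) (w : S.la α s h = S.ra s' β h') : X ⟶ S.Sq :=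
  pullback.lift (pullback.lift α s h) (pullback.lift s' β h')
    (show pullback.lift α s h ≫ S.lam = pullback.lift s' β h' ≫ S.rho from w)

section
variable (α : X ⟶ A.C₁) (s s' : X ⟶ S.S₀) (β : X ⟶ B.C₁) (h : α ≫ A.d = s ≫ S.L)
    (h' : s' ≫ S.R = β ≫ B.c) (w : S.la α s h = S.ra s' β h')

@[simp] lemma sqMk_α : S.sqMk α s s' β h h' w ≫ S.sqα = α := by
  rw [sqMk, sqα, pullback.lift_fst_assoc, pullback.lift_fst]
@[simp] lemma sqMk_s : S.sqMk α s s' β h h' w ≫ S.sqs = s := by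
  rw [sqMk, sqs, pullback.lift_fst_assoc, pullback.lift_snd]
@[simp] lemma sqMk_s' : S.sqMk α s s' β h h' w ≫ S.sqs' = s' := by
  rw [sqMk, sqs', pullback.lift_snd_assoc, pullback.lift_fst]
@[simp] lemma sqMk_β : S.sqMk α s s' β h h' w ≫ S.sqβ = β := by
  rw [sqMk, sqβ, pullback.lift_snd_assoc, pullback.lift_snd]

end

variable {S} in
lemma sq_ext {f g : X ⟶ S.Sq} (hα : f ≫ S.sqα = g ≫ S.sqα) (hs : f ≫ S.sqs = g ≫ S.sqs)
    (hs' : f ≫ S.sqs' = g ≫ S.sqs') (hβ : f ≫ S.sqβ = g ≫ S.sqβ) : f = g := by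
  apply pullback.hom_ext <;> apply pullback.hom_ext <;>
    simpa only [sqα, sqs, sqs', sqβ, Category.assoc]

/-- Conditions for two squares being composable. -/
lemma sq_precond {f g : X ⟶ S.Sq} (h : f ≫ S.sqs' = g ≫ S.sqs) :
    (f ≫ S.sqα) ≫ A.c = (g ≫ S.sqα) ≫ A.d ∧ (f ≫ S.sqβ) ≫ B.c = (g ≫ S.sqβ) ≫ B.d := by
  simp [sqα_c, sqα_d, sqβ_d, ← sqβ_c, reassoc_of% h]

lemma sq_comp_aux {f g : X ⟶ S.Sq} (h : f ≫ S.sqs' = g ≫ S.sqs) :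
    S.la (A.comp (f ≫ S.sqα) (g ≫ S.sqα) (S.sq_precond h).1) (f ≫ S.sqs)
        (by rw [IntGpd.comp_d, Category.assoc, Category.assoc, sqα_d]) =
      S.ra (g ≫ S.sqs') (B.comp (f ≫ S.sqβ) (g ≫ S.sqβ) (S.sq_precond h).2)
        (by rw [IntGpd.comp_c, Category.assoc, Category.assoc, sqβ_c]) := by
  have hf : S.la (f ≫ S.sqα) (f ≫ S.sqs) (by simp [sqα_d]) =
      S.ra (g ≫ S.sqs) (f ≫ S.sqβ) (by simp [← h, sqβ_c]) := by
    rw [← precomp_la _ _ _ S.sqα_d, sq_comm, precomp_ra]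
    exact ra_congr _ h rfl
  have hg : S.la (g ≫ S.sqα) (g ≫ S.sqs) (by simp [sqα_d]) =
      S.ra (g ≫ S.sqs') (g ≫ S.sqβ) (by simp [sqβ_c]) := by
    rw [← precomp_la _ _ _ S.sqα_d, sq_comm, precomp_ra]
  rw [la_la _ _ _ _ (by simp [sqα_d]), ra_ra _ _ _ _ (by simp [sqβ_c]), la_congr _ rfl hf,
    ra_congr _ hg.symm rfl,
    la_ra _ _ _ (by simp [sqα_d]) (by simp [← h, sqβ_c])]

lemma sq_inv_aux : S.la (S.sqα ≫ A.τ) S.sqs' (by simp [A.τ_d, sqα_c]) =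
    S.ra S.sqs (S.sqβ ≫ B.τ) (by simp [B.τ_c, sqβ_d]) := by
  have h₁ : S.ra (S.la S.sqα S.sqs S.sqα_d) (S.sqβ ≫ B.τ) (by simp [B.τ_c, sqβ_d, la_R]) =
      S.sqs' := by
    rw [ra_congr _ S.sq_comm rfl, ← ra_ra _ _ _ (by simp [B.τ_c]),
      ra_congr _ rfl (IntGpd.inv_comp _)]
    simpa using ra_unit S.sqs' (S.sqβ ≫ B.c) S.sqβ_c
  rw [la_ra _ _ _ S.sqα_d (by simp [B.τ_c, sqβ_d])] at h₁
  rw [la_congr _ rfl h₁.symm, ← la_la _ _ _ (by simp [A.τ_d]), la_congr _ (IntGpd.comp_inv _) rfl]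
  simpa using la_unit (S.ra S.sqs (S.sqβ ≫ B.τ) (by simp [B.τ_c, sqβ_d])) (S.sqα ≫ A.d)
    (by simp [ra_L, sqα_d])

/-- The groupoid associated with a distributor: objects `S₀`, arrows the squares `S₁`, and
structure maps `(α, s, s', β) ↦ s` (domain) and `(α, s, s', β) ↦ s'` (codomain), with identities,
composition and inversion componentwise. -/
noncomputable def total : IntGpd E where
  C₀ := S.S₀
  C₁ := S.Sq
  d := S.sqs
  c := S.sqs'
  e := S.sqMk (S.L ≫ A.e) (𝟙 _) (𝟙 _) (S.R ≫ B.e) (by simp [A.e_d]) (by simp [B.e_c])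
    (by rw [la_unit _ _ (by simp), ra_unit _ _ (by simp)])
  m := S.sqMk _ _ _ _ _ _ (S.sq_comp_aux (pullback.condition (f := S.sqs') (g := S.sqs)))
  τ := S.sqMk (S.sqα ≫ A.τ) S.sqs' S.sqs (S.sqβ ≫ B.τ) (by simp [A.τ_d, sqα_c])
    (by simp [B.τ_c, sqβ_d]) S.sq_inv_aux
  e_d := by simp
  e_c := by simp
  m_d := by simp
  m_c := by simp
  id_m := by
    apply sq_ext
    · simp [IntGpd.precomp]
      refine (IntGpd.comp_congr _ ?_ ?_).trans (IntGpd.id_comp _ _ rfl) <;> simp [sqα_d]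
    · simp
    · simp
    · simp [IntGpd.precomp]
      refine (IntGpd.comp_congr _ ?_ ?_).trans (IntGpd.id_comp _ _ rfl) <;> simp [sqβ_d]
  m_id := by
    apply sq_ext
    · simp [IntGpd.precomp]
      refine (IntGpd.comp_congr _ ?_ ?_).trans (IntGpd.comp_id _ _ rfl) <;> simp [sqα_c]
    · simp
    · simp
    · simp [IntGpd.precomp]
      refine (IntGpd.comp_congr _ ?_ ?_).trans (IntGpd.comp_id _ _ rfl) <;>
        simp [reassoc_of% S.sqβ_c]
  m_assoc f g h hfg hgh := by
    apply sq_ext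
    · simp only [Category.assoc, sqMk_α, IntGpd.precomp, pullback.lift_fst_assoc,
        pullback.lift_snd_assoc]
      exact IntGpd.assoc _ _ _ (S.sq_precond hfg).1 (S.sq_precond hgh).1
    · simp
    · simp
    · simp only [Category.assoc, sqMk_β, IntGpd.precomp, pullback.lift_fst_assoc,
        pullback.lift_snd_assoc]
      exact IntGpd.assoc _ _ _ (S.sq_precond hfg).2 (S.sq_precond hgh).2
  τ_d := by simp
  τ_c := by simp
  m_τ := by
    apply sq_ext
    · simp [IntGpd.precomp]
      refine (IntGpd.comp_inv S.sqα).trans ?_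
      simp [reassoc_of% S.sqα_d]
    · simp
    · simp
    · simp [IntGpd.precomp]
      refine (IntGpd.comp_inv S.sqβ).trans ?_
      simp [reassoc_of% S.sqβ_d]
  τ_m := by
    apply sq_ext
    · simp [IntGpd.precomp]
      refine (IntGpd.inv_comp S.sqα).trans ?_
      simp [reassoc_of% S.sqα_c]
    · simp
    · simp
    · simp [IntGpd.precomp]
      refine (IntGpd.inv_comp S.sqβ).trans ?_
      simp [reassoc_of% S.sqβ_c]

/-- The left leg of the span of internal groupoids associated with a distributor. -/
noncomputable def legL : S.total ⟶ A where
  F₀ := S.L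
  F₁ := S.sqα
  map_d := S.sqα_d
  map_c := S.sqα_c
  map_e := by simp [total]
  map_m := by dsimp only [total]; rw [sqMk_α]

/-- The right leg of the span of internal groupoids associated with a distributor. -/
noncomputable def legR : S.total ⟶ B where
  F₀ := S.R
  F₁ := S.sqβ
  map_d := S.sqβ_d
  map_c := S.sqβ_c.symm
  map_e := by simp [total]
  map_m := by dsimp only [total]; rw [sqMk_β]

/-- The functor `⟨L, R⟩ : 𝕊 ⟶ A × B`. -/
noncomputable def leg : S.total ⟶ A.prod B := IntGpd.pair S.legL S.legR

variable (T : Distributor B C)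

/-- The composite `T ◇ S` of the spans associated with `S` and `T`. -/
noncomputable def spanComp : IntGpd E := IntGpd.pb S.legR T.legL

/-- The functor from the composite span `T ◇ S` to `A × C`. -/
noncomputable def spanCompLeg : S.spanComp T ⟶ A.prod C :=
  IntGpd.pair (IntGpd.pbFst S.legR T.legL ≫ S.legL) (IntGpd.pbSnd S.legR T.legL ≫ T.legR)

end Distributor

end Groupoids

section

variable {E : Type u} [Category.{v} E]

lemma hasCoequalizer_of_exists {G₁ G₀ : E} {d c : G₁ ⟶ G₀}
    (H : ∃ (Q : E) (q : G₀ ⟶ Q) (w : d ≫ q = c ≫ q), Nonempty (IsColimit (Cofork.ofπ q w)) ∧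
      ∀ {X : E} (x y : X ⟶ G₀), x ≫ q = y ≫ q →
        ∃ (X' : E) (p : X' ⟶ X) (h : X' ⟶ G₁),
          IsRegularEpi p ∧ h ≫ d = p ≫ x ∧ h ≫ c = p ≫ y) :
    HasCoequalizer d c := by
  obtain ⟨Q, q, w, ⟨hq⟩, -⟩ := H
  exact ⟨⟨⟨_, hq⟩⟩⟩

lemma exists_cover_of_exists {G₁ G₀ : E} {d c : G₁ ⟶ G₀} [HasCoequalizer d c]
    (H : ∃ (Q : E) (q : G₀ ⟶ Q) (w : d ≫ q = c ≫ q), Nonempty (IsColimit (Cofork.ofπ q w)) ∧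
      ∀ {X : E} (x y : X ⟶ G₀), x ≫ q = y ≫ q →
        ∃ (X' : E) (p : X' ⟶ X) (h : X' ⟶ G₁), IsRegularEpi p ∧ h ≫ d = p ≫ x ∧ h ≫ c = p ≫ y)
    {X : E} (x y : X ⟶ G₀) (hxy : x ≫ coequalizer.π d c = y ≫ coequalizer.π d c) :
    ∃ (X' : E) (p : X' ⟶ X) (h : X' ⟶ G₁),
      IsRegularEpi p ∧ h ≫ d = p ≫ x ∧ h ≫ c = p ≫ y := by
  obtain ⟨Q, q, w, -, H⟩ := H
  refine H x y ?_
  rw [← coequalizer.π_desc q w, reassoc_of% hxy]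

/-- Morphisms descend along a regular epimorphism. -/
lemma exists_desc {X Y Z : E} (f : X ⟶ Y) [IsRegularEpi f] (g : X ⟶ Z)
    (h : ∀ {W : E} (u v : W ⟶ X), u ≫ f = v ≫ f → u ≫ g = v ≫ g) : ∃ k : Y ⟶ Z, f ≫ k = g := by
  have r := IsRegularEpi.getStruct f
  exact ⟨Cofork.IsColimit.desc r.isColimit g (h _ _ r.w),
    Cofork.IsColimit.π_desc' r.isColimit g (h _ _ r.w)⟩

end

/-! ### Quotients of internal groupoids and composition of distributors -/

section Exact

attribute [local simp] pullback.lift_fst pullback.lift_snd pullback.lift_fst_assoc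
  pullback.lift_snd_assoc prod.lift_fst prod.lift_snd prod.lift_fst_assoc prod.lift_snd_assoc

variable {E : Type u} [Category.{v} E] [BarrExact E]

/-- In a Barr-exact category, a reflexive, symmetric and transitive pair has a coequalizer `q`, and
two generalized elements identified by `q` are, after a regular epimorphic covering, related by
the pair. -/
lemma exists_quotient {G₁ G₀ : E} (d c : G₁ ⟶ G₀) (r : G₀ ⟶ G₁) (rd : r ≫ d = 𝟙 _)
    (rc : r ≫ c = 𝟙 _) (t : G₁ ⟶ G₁) (td : t ≫ d = c) (tc : t ≫ c = d)
    (m : pullback c d ⟶ G₁) (md : m ≫ d = pullback.fst c d ≫ d)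
    (mc : m ≫ c = pullback.snd c d ≫ c) :
    ∃ (Q : E) (q : G₀ ⟶ Q) (w : d ≫ q = c ≫ q), Nonempty (IsColimit (Cofork.ofπ q w)) ∧
      ∀ {X : E} (x y : X ⟶ G₀), x ≫ q = y ≫ q →
        ∃ (X' : E) (p : X' ⟶ X) (h : X' ⟶ G₁), IsRegularEpi p ∧ h ≫ d = p ≫ x ∧ h ≫ c = p ≫ y := by
  obtain ⟨I, j, e, hj, he, hje⟩ : ∃ (I : E) (j : I ⟶ G₀ ⨯ G₀) (e : G₁ ⟶ I), Mono j ∧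
      IsRegularEpi e ∧ e ≫ j = prod.lift d c :=
    let F := Regular.strongEpiMonoFactorisation (prod.lift d c)
    ⟨F.I, F.m, F.e, F.m_mono, inferInstanceAs
      (IsRegularEpi (Regular.strongEpiMonoFactorisation (prod.lift d c)).e), F.fac⟩
  have e₁ : e ≫ j ≫ prod.fst = d := by rw [reassoc_of% hje, prod.lift_fst]
  have e₂ : e ≫ j ≫ prod.snd = c := by rw [reassoc_of% hje, prod.lift_snd]
  have sqs : CommSq (t ≫ e) e j (j ≫ prod.lift prod.snd prod.fst) := ⟨by
    ext <;> simp [e₁, e₂, td, tc]⟩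
  let k₁ := pullback.fst (pullback.fst (j ≫ prod.snd) (j ≫ prod.fst)) e
  let u := pullback.snd (pullback.fst (j ≫ prod.snd) (j ≫ prod.fst)) e
  let k₂ := pullback.fst (k₁ ≫ pullback.snd (j ≫ prod.snd) (j ≫ prod.fst)) e
  let v := pullback.snd (k₁ ≫ pullback.snd (j ≫ prod.snd) (j ≫ prod.fst)) e
  have hu : k₁ ≫ pullback.fst (j ≫ prod.snd) (j ≫ prod.fst) = u ≫ e := pullback.condition
  have hv : k₂ ≫ k₁ ≫ pullback.snd (j ≫ prod.snd) (j ≫ prod.fst) = v ≫ e := by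
    exact pullback.condition (f := k₁ ≫ pullback.snd (j ≫ prod.snd) (j ≫ prod.fst)) (g := e)
  have huv : (k₂ ≫ u) ≫ c = v ≫ d := by
    rw [← e₁, ← reassoc_of% hv, ← pullback.condition (f := j ≫ prod.snd) (g := j ≫ prod.fst),
      reassoc_of% hu, e₂, Category.assoc]
  have sqt : CommSq (pullback.lift (k₂ ≫ u) v huv ≫ m ≫ e) (k₂ ≫ k₁) j
      (prod.lift (pullback.fst (j ≫ prod.snd) (j ≫ prod.fst) ≫ j ≫ prod.fst)
        (pullback.snd (j ≫ prod.snd) (j ≫ prod.fst) ≫ j ≫ prod.snd)) := ⟨by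
    ext
    · simp [e₁, md, reassoc_of% hu]
    · simp [e₂, mc, reassoc_of% hv]⟩
  have : StrongEpi (k₂ ≫ k₁) := strongEpi_comp _ _
  have t₁ : sqt.lift ≫ j ≫ prod.fst =
      pullback.fst (j ≫ prod.snd) (j ≫ prod.fst) ≫ j ≫ prod.fst := by
    rw [sqt.fac_right_assoc, prod.lift_fst]
  have t₂ : sqt.lift ≫ j ≫ prod.snd =
      pullback.snd (j ≫ prod.snd) (j ≫ prod.fst) ≫ j ≫ prod.snd := by
    rw [sqt.fac_right_assoc, prod.lift_snd]
  have eqv : EquivalenceRelation (j ≫ prod.fst) (j ≫ prod.snd) :=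
    { right_cancellation := fun Y f g h₁ h₂ => by
        rw [← cancel_mono j]; ext <;> simpa
      r := r ≫ e
      reflexivity₁ := by simp [e₁, rd]
      reflexivity₂ := by simp [e₂, rc]
      s := sqs.lift
      symmetry₁ := by rw [sqs.fac_right_assoc]; simp
      symmetry₂ := by rw [sqs.fac_right_assoc]; simp
      c := _
      isLimit := pullbackIsPullback (j ≫ prod.snd) (j ≫ prod.fst)
      t := sqt.lift
      transitivity₁ := t₁
      transitivity₂ := t₂ }
  obtain ⟨⟨eff⟩⟩ := BarrExact.effective _ _ eqv.isEquivalenceRelation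
  have w : d ≫ eff.π = c ≫ eff.π := by
    have := congrArg (fun t => e ≫ t) eff.isKernelPair.w
    simpa [reassoc_of% e₁, reassoc_of% e₂] using this
  refine ⟨eff.B, eff.π, w, ⟨?_⟩, ?_⟩
  · refine Cofork.IsColimit.mk' _ fun s => ?_
    have hs : (j ≫ prod.fst) ≫ s.π = (j ≫ prod.snd) ≫ s.π := by
      rw [← cancel_epi e]
      simpa [reassoc_of% e₁, reassoc_of% e₂] using s.condition
    refine ⟨Cofork.IsColimit.desc eff.isCoequalizer s.π hs,
      Cofork.IsColimit.π_desc' eff.isCoequalizer s.π hs, fun {m} hm => ?_⟩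
    apply Cofork.IsColimit.hom_ext eff.isCoequalizer
    exact hm.trans (Cofork.IsColimit.π_desc' eff.isCoequalizer s.π hs).symm
  · intro X x y hxy
    let k := eff.isKernelPair.lift x y hxy
    refine ⟨_, pullback.fst k e, pullback.snd k e, inferInstance, ?_, ?_⟩
    · rw [← e₁, ← pullback.condition_assoc, eff.isKernelPair.lift_fst]
    · rw [← e₂, ← pullback.condition_assoc, eff.isKernelPair.lift_snd]

instance (G : IntGpd E) : HasCoequalizer G.d G.c :=
  hasCoequalizer_of_exists
    (exists_quotient G.d G.c G.e G.e_d G.e_c G.τ G.τ_d G.τ_c G.m G.m_d G.m_c)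

/-- The object of connected components of an internal groupoid. -/
noncomputable def Pi0 (G : IntGpd E) : E := coequalizer G.d G.c

/-- The action of `Π₀` on internal functors. -/
noncomputable def Pi0.map {G H : IntGpd E} (F : G ⟶ H) : Pi0 G ⟶ Pi0 H :=
  show coequalizer G.d G.c ⟶ coequalizer H.d H.c from
    coequalizer.desc (F.F₀ ≫ coequalizer.π H.d H.c) (by
      rw [← reassoc_of% F.map_d, ← reassoc_of% F.map_c, coequalizer.condition])

/-- `F` is internally essentially surjective: `Π₀(F)` is an isomorphism. -/
def IsEssSurj {G H : IntGpd E} (F : G ⟶ H) : Prop := IsIso (Pi0.map F)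

namespace Distributor

variable {A B C : IntGpd E} (S : Distributor A B) (T : Distributor B C) {X Y : E}

/-- The object `S₀ ×_{B₀} T₀` of pairs `(s, t)`. -/
noncomputable abbrev Pairs : E := pullback S.R T.L

/-- The object `S₀ ×_{B₀} B₁ ×_{B₀} T₀` of triples `(s, β, t)` with `R s = c β` and `d β = L t`. -/
noncomputable abbrev Triples : E := pullback (pullback.snd S.R B.c ≫ B.d) T.L

/-- The component `s` of a triple. -/
noncomputable def trs : S.Triples T ⟶ S.S₀ :=
  pullback.fst (pullback.snd S.R B.c ≫ B.d) T.L ≫ pullback.fst S.R B.c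

/-- The component `β` of a triple. -/
noncomputable def trβ : S.Triples T ⟶ B.C₁ :=
  pullback.fst (pullback.snd S.R B.c ≫ B.d) T.L ≫ pullback.snd S.R B.c

/-- The component `t` of a triple. -/
noncomputable def trt : S.Triples T ⟶ T.S₀ :=
  pullback.snd (pullback.snd S.R B.c ≫ B.d) T.L

lemma trs_R : S.trs T ≫ S.R = S.trβ T ≫ B.c := by simp [trs, trβ, pullback.condition]

lemma trt_L : S.trβ T ≫ B.d = S.trt T ≫ T.L := by
  rw [trt, trβ, ← pullback.condition, Category.assoc]

/-- The generalized triple with given components. -/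
noncomputable def trMk (s : X ⟶ S.S₀) (β : X ⟶ B.C₁) (t : X ⟶ T.S₀) (h : s ≫ S.R = β ≫ B.c)
    (h' : β ≫ B.d = t ≫ T.L) : X ⟶ S.Triples T :=
  pullback.lift (pullback.lift s β h) t (by rw [pullback.lift_snd_assoc, h'])

section
variable (s : X ⟶ S.S₀) (β : X ⟶ B.C₁) (t : X ⟶ T.S₀) (h : s ≫ S.R = β ≫ B.c)
    (h' : β ≫ B.d = t ≫ T.L)

@[simp] lemma trMk_s : S.trMk T s β t h h' ≫ S.trs T = s := by
  rw [trMk, trs, pullback.lift_fst_assoc, pullback.lift_fst]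
@[simp] lemma trMk_β : S.trMk T s β t h h' ≫ S.trβ T = β := by
  rw [trMk, trβ, pullback.lift_fst_assoc, pullback.lift_snd]
@[simp] lemma trMk_t : S.trMk T s β t h h' ≫ S.trt T = t := by
  rw [trMk, trt, pullback.lift_snd]

end

/-- The morphism `ρ_S × id`, sending `(s, β, t)` to `(s · β, t)`. -/
noncomputable def hd : S.Triples T ⟶ S.Pairs T :=
  pullback.lift (S.ra (S.trs T) (S.trβ T) (S.trs_R T)) (S.trt T) (by rw [ra_R, trt_L])

/-- The morphism `id × λ_T`, sending `(s, β, t)` to `(s, β · t)`. -/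
noncomputable def hc : S.Triples T ⟶ S.Pairs T :=
  pullback.lift (S.trs T) (T.la (S.trβ T) (S.trt T) (S.trt_L T)) (by rw [la_L, trs_R])

@[simp] lemma hd_fst : S.hd T ≫ pullback.fst S.R T.L = S.ra (S.trs T) (S.trβ T) (S.trs_R T) := by
  simp [hd]
@[simp] lemma hd_snd : S.hd T ≫ pullback.snd S.R T.L = S.trt T := by simp [hd]
@[simp] lemma hc_fst : S.hc T ≫ pullback.fst S.R T.L = S.trs T := by simp [hc]
@[simp] lemma hc_snd : S.hc T ≫ pullback.snd S.R T.L = T.la (S.trβ T) (S.trt T) (S.trt_L T) := by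
  simp [hc]

lemma hd_fst' (h : X ⟶ S.Triples T) : (h ≫ S.hd T) ≫ pullback.fst S.R T.L =
    S.ra (h ≫ S.trs T) (h ≫ S.trβ T) (by simp [trs_R]) := by
  rw [Category.assoc, hd_fst, precomp_ra]

lemma hc_snd' (h : X ⟶ S.Triples T) : (h ≫ S.hc T) ≫ pullback.snd S.R T.L =
    T.la (h ≫ S.trβ T) (h ≫ S.trt T) (by simp [trt_L]) := by
  rw [Category.assoc, hc_snd, precomp_la]

lemma tr_comp_aux {f g : X ⟶ S.Triples T} (h : f ≫ S.hc T = g ≫ S.hd T) :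
    f ≫ S.trs T = S.ra (g ≫ S.trs T) (g ≫ S.trβ T) (by simp [trs_R]) ∧
    T.la (f ≫ S.trβ T) (f ≫ S.trt T) (by simp [trt_L]) = g ≫ S.trt T := by
  constructor
  · have := congrArg (fun t => t ≫ pullback.fst S.R T.L) h
    simpa [precomp_ra] using this
  · have := congrArg (fun t => t ≫ pullback.snd S.R T.L) h
    simpa [precomp_la] using this

lemma tr_comp_aux' {f g : X ⟶ S.Triples T} (h : f ≫ S.hc T = g ≫ S.hd T) :
    (f ≫ S.trβ T) ≫ B.c = (g ≫ S.trβ T) ≫ B.d := by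
  rw [Category.assoc, ← trs_R, ← Category.assoc, (S.tr_comp_aux T h).1, ra_R]

lemma tensor_exists_quotient :
    ∃ (Q : E) (q : S.Pairs T ⟶ Q) (w : S.hd T ≫ q = S.hc T ≫ q),
      Nonempty (IsColimit (Cofork.ofπ q w)) ∧
      ∀ {X : E} (x y : X ⟶ S.Pairs T), x ≫ q = y ≫ q →
        ∃ (X' : E) (p : X' ⟶ X) (h : X' ⟶ S.Triples T),
          IsRegularEpi p ∧ h ≫ S.hd T = p ≫ x ∧ h ≫ S.hc T = p ≫ y := by
  have hm := S.tr_comp_aux T (pullback.condition (f := S.hc T) (g := S.hd T))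
  have hm' := S.tr_comp_aux' T (pullback.condition (f := S.hc T) (g := S.hd T))
  refine exists_quotient (S.hd T) (S.hc T)
    (S.trMk T (pullback.fst _ _) ((pullback.fst _ _ ≫ S.R) ≫ B.e) (pullback.snd _ _)
      (by simp [B.e_c]) (by simp [B.e_d, pullback.condition])) ?_ ?_
    (S.trMk T (S.ra (S.trs T) (S.trβ T) (S.trs_R T)) (S.trβ T ≫ B.τ)
      (T.la (S.trβ T) (S.trt T) (S.trt_L T)) (by simp [ra_R, B.τ_c]) (by simp [la_L, B.τ_d])) ?_ ?_
    (S.trMk T (pullback.snd (S.hc T) (S.hd T) ≫ S.trs T)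
      (B.comp (pullback.fst (S.hc T) (S.hd T) ≫ S.trβ T)
        (pullback.snd (S.hc T) (S.hd T) ≫ S.trβ T) hm')
      (pullback.fst (S.hc T) (S.hd T) ≫ S.trt T)
      (by simp [IntGpd.comp_c, trs_R]) (by simp [IntGpd.comp_d, trt_L])) ?_ ?_
  · ext
    · rw [hd_fst']
      refine (ra_congr _ ?_ ?_).trans ((ra_unit _ _ rfl).trans (Category.id_comp _).symm) <;> simp
    · simp
  · ext
    · simp
    · rw [hc_snd']
      refine (la_congr _ ?_ ?_).trans ((la_unit (S := T) _ _
        (pullback.condition (f := S.R) (g := T.L)).symm).trans (Category.id_comp _).symm) <;> simp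
  · ext
    · rw [hd_fst', ra_congr _ (trMk_s ..) (trMk_β ..),
        ← ra_ra _ _ _ (by simp [B.τ_c]), ra_congr _ rfl (IntGpd.inv_comp _), hc_fst]
      simpa using ra_unit (S.trs T) (S.trβ T ≫ B.c) (S.trs_R T)
    · simp
  · ext
    · simp
    · rw [hc_snd', la_congr _ (trMk_β ..) (trMk_t ..),
        ← la_la _ _ _ (by simp [B.τ_d]), la_congr _ (IntGpd.comp_inv _) rfl, hd_snd]
      simpa using la_unit (S.trt T) (S.trβ T ≫ B.d) (S.trt_L T).symm
  · ext
    · rw [hd_fst', ra_congr _ (trMk_s ..) (trMk_β ..),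
        ra_ra _ _ _ _ (by simp [trs_R]), hd_fst']
      exact ra_congr _ hm.1.symm rfl
    · simp
  · ext
    · simp
    · rw [hc_snd', la_congr _ (trMk_β ..) (trMk_t ..),
        la_la _ _ _ _ (by simp [trt_L]), hc_snd']
      exact la_congr _ rfl hm.2

instance : HasCoequalizer (S.hd T) (S.hc T) := hasCoequalizer_of_exists (S.tensor_exists_quotient T)

/-- The object `(T ⊗ S)₀`: the coequalizer of `ρ_S × id` and `id × λ_T`. -/
noncomputable def tensorObj : E := coequalizer (S.hd T) (S.hc T)

/-- The coequalizer `Q₀ : S₀ ×_{B₀} T₀ ⟶ (T ⊗ S)₀`. -/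
noncomputable def tensorπ : S.Pairs T ⟶ S.tensorObj T := coequalizer.π (S.hd T) (S.hc T)

/-- The induced leg `(T ⊗ S)₀ ⟶ A₀`. -/
noncomputable def tensorL : S.tensorObj T ⟶ A.C₀ :=
  coequalizer.desc (pullback.fst S.R T.L ≫ S.L) (by
    rw [← Category.assoc, ← Category.assoc, hd_fst, hc_fst, ra_L])

/-- The induced leg `(T ⊗ S)₀ ⟶ C₀`. -/
noncomputable def tensorR : S.tensorObj T ⟶ C.C₀ :=
  coequalizer.desc (pullback.snd S.R T.L ≫ T.R) (by
    rw [← Category.assoc, ← Category.assoc, hd_snd, hc_snd, la_R])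

@[simp] lemma tensorπ_L : S.tensorπ T ≫ S.tensorL T = pullback.fst S.R T.L ≫ S.L :=
  coequalizer.π_desc _ _

@[simp] lemma tensorπ_R : S.tensorπ T ≫ S.tensorR T = pullback.snd S.R T.L ≫ T.R :=
  coequalizer.π_desc _ _

instance : IsRegularEpi (S.tensorπ T) :=
  inferInstanceAs (IsRegularEpi (coequalizer.π (S.hd T) (S.hc T)))

section
variable {S}

/-- `α · (s, t) = (α · s, t)`. -/
noncomputable def pla (α : X ⟶ A.C₁) (z : X ⟶ S.Pairs T)
    (h : α ≫ A.d = z ≫ pullback.fst S.R T.L ≫ S.L) : X ⟶ S.Pairs T :=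
  pullback.lift (S.la α (z ≫ pullback.fst S.R T.L) (by rw [h, Category.assoc]))
    (z ≫ pullback.snd S.R T.L)
    (by rw [la_R, Category.assoc, Category.assoc, pullback.condition])

/-- `(s, t) · γ = (s, t · γ)`. -/
noncomputable def pra (z : X ⟶ S.Pairs T) (γ : X ⟶ C.C₁)
    (h : z ≫ pullback.snd S.R T.L ≫ T.R = γ ≫ C.c) : X ⟶ S.Pairs T :=
  pullback.lift (z ≫ pullback.fst S.R T.L)
    (T.ra (z ≫ pullback.snd S.R T.L) γ (by rw [← h, Category.assoc]))
    (by rw [ra_L, Category.assoc, Category.assoc, pullback.condition])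

variable {T}

@[simp] lemma pla_fst (α : X ⟶ A.C₁) (z : X ⟶ S.Pairs T)
    (h : α ≫ A.d = z ≫ pullback.fst S.R T.L ≫ S.L) :
    pla T α z h ≫ pullback.fst S.R T.L =
      S.la α (z ≫ pullback.fst S.R T.L) (by rw [h, Category.assoc]) := by simp [pla]

@[simp] lemma pla_snd (α : X ⟶ A.C₁) (z : X ⟶ S.Pairs T)
    (h : α ≫ A.d = z ≫ pullback.fst S.R T.L ≫ S.L) :
    pla T α z h ≫ pullback.snd S.R T.L = z ≫ pullback.snd S.R T.L := by simp [pla]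

@[simp] lemma pra_fst (z : X ⟶ S.Pairs T) (γ : X ⟶ C.C₁)
    (h : z ≫ pullback.snd S.R T.L ≫ T.R = γ ≫ C.c) :
    pra T z γ h ≫ pullback.fst S.R T.L = z ≫ pullback.fst S.R T.L := by simp [pra]

@[simp] lemma pra_snd (z : X ⟶ S.Pairs T) (γ : X ⟶ C.C₁)
    (h : z ≫ pullback.snd S.R T.L ≫ T.R = γ ≫ C.c) :
    pra T z γ h ≫ pullback.snd S.R T.L =
      T.ra (z ≫ pullback.snd S.R T.L) γ (by rw [← h, Category.assoc]) := by simp [pra]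

lemma pla_π_L (α : X ⟶ A.C₁) (z : X ⟶ S.Pairs T)
    (h : α ≫ A.d = z ≫ pullback.fst S.R T.L ≫ S.L) :
    pla T α z h ≫ S.tensorπ T ≫ S.tensorL T = α ≫ A.c := by
  rw [tensorπ_L, ← Category.assoc, pla_fst, la_L]

lemma pra_π_R (z : X ⟶ S.Pairs T) (γ : X ⟶ C.C₁)
    (h : z ≫ pullback.snd S.R T.L ≫ T.R = γ ≫ C.c) :
    pra T z γ h ≫ S.tensorπ T ≫ S.tensorR T = γ ≫ C.d := by
  rw [tensorπ_R, ← Category.assoc, pra_snd, ra_R]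

lemma precomp_pla (k : Y ⟶ X) (α : X ⟶ A.C₁) (z : X ⟶ S.Pairs T)
    (h : α ≫ A.d = z ≫ pullback.fst S.R T.L ≫ S.L) :
    k ≫ pla T α z h = pla T (k ≫ α) (k ≫ z) (by simp [h]) := by
  ext <;> simp [precomp_la]

lemma precomp_pra (k : Y ⟶ X) (z : X ⟶ S.Pairs T) (γ : X ⟶ C.C₁)
    (h : z ≫ pullback.snd S.R T.L ≫ T.R = γ ≫ C.c) :
    k ≫ pra T z γ h = pra T (k ≫ z) (k ≫ γ) (by simp [h]) := by
  ext <;> simp [precomp_ra]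

lemma pla_congr {α α' : X ⟶ A.C₁} {z z' : X ⟶ S.Pairs T}
    (h : α ≫ A.d = z ≫ pullback.fst S.R T.L ≫ S.L) (hα : α = α') (hz : z = z') :
    pla T α z h = pla T α' z' (by rw [← hα, ← hz, h]) := by subst hα hz; rfl

lemma pra_congr {γ γ' : X ⟶ C.C₁} {z z' : X ⟶ S.Pairs T}
    (h : z ≫ pullback.snd S.R T.L ≫ T.R = γ ≫ C.c) (hz : z = z') (hγ : γ = γ') :
    pra T z γ h = pra T z' γ' (by rw [← hγ, ← hz, h]) := by subst hγ hz; rfl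

lemma exists_triple (x y : X ⟶ S.Pairs T) (hxy : x ≫ S.tensorπ T = y ≫ S.tensorπ T) :
    ∃ (X' : E) (p : X' ⟶ X) (h : X' ⟶ S.Triples T),
      IsRegularEpi p ∧ h ≫ S.hd T = p ≫ x ∧ h ≫ S.hc T = p ≫ y :=
  exists_cover_of_exists (S.tensor_exists_quotient T) x y hxy

lemma hd_π : S.hd T ≫ S.tensorπ T = S.hc T ≫ S.tensorπ T := coequalizer.condition _ _

lemma pla_π_eq (α : X ⟶ A.C₁) (x y : X ⟶ S.Pairs T)
    (hx : α ≫ A.d = x ≫ pullback.fst S.R T.L ≫ S.L)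
    (hy : α ≫ A.d = y ≫ pullback.fst S.R T.L ≫ S.L)
    (hxy : x ≫ S.tensorπ T = y ≫ S.tensorπ T) :
    pla T α x hx ≫ S.tensorπ T = pla T α y hy ≫ S.tensorπ T := by
  obtain ⟨X', p, h, hp, h₁, h₂⟩ := exists_triple x y hxy
  have hα : (p ≫ α) ≫ A.d = (h ≫ S.trs T) ≫ S.L := by
    rw [Category.assoc, hy, ← reassoc_of% h₂, reassoc_of% S.hc_fst T, Category.assoc]
  let h' : X' ⟶ S.Triples T := S.trMk T (S.la (p ≫ α) (h ≫ S.trs T) hα) (h ≫ S.trβ T)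
    (h ≫ S.trt T) (by rw [la_R, Category.assoc, Category.assoc, trs_R])
    (by rw [Category.assoc, Category.assoc, trt_L])
  have e₁ : h' ≫ S.hd T = p ≫ pla T α x hx := by
    rw [precomp_pla]
    ext
    · rw [hd_fst', pla_fst, ra_congr _ (trMk_s ..) (trMk_β ..),
        la_ra _ _ _ hα (by simp [trs_R])]
      refine la_congr _ rfl ?_
      rw [← h₁, hd_fst']
    · rw [Category.assoc, hd_snd, pla_snd, ← h₁, Category.assoc, hd_snd, trMk_t]
  have e₂ : h' ≫ S.hc T = p ≫ pla T α y hy := by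
    rw [precomp_pla]
    ext
    · rw [Category.assoc, hc_fst, pla_fst, trMk_s]
      refine la_congr _ rfl ?_
      rw [← h₂, Category.assoc, hc_fst]
    · rw [Category.assoc, hc_snd, pla_snd, ← h₂, hc_snd', precomp_la]
      exact la_congr _ (trMk_β ..) (trMk_t ..)
  rw [← cancel_epi p, ← reassoc_of% e₁, ← reassoc_of% e₂, hd_π]

lemma pra_π_eq (γ : X ⟶ C.C₁) (x y : X ⟶ S.Pairs T)
    (hx : x ≫ pullback.snd S.R T.L ≫ T.R = γ ≫ C.c)
    (hy : y ≫ pullback.snd S.R T.L ≫ T.R = γ ≫ C.c)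
    (hxy : x ≫ S.tensorπ T = y ≫ S.tensorπ T) :
    pra T x γ hx ≫ S.tensorπ T = pra T y γ hy ≫ S.tensorπ T := by
  obtain ⟨X', p, h, hp, h₁, h₂⟩ := exists_triple x y hxy
  have hγ : (h ≫ S.trt T) ≫ T.R = (p ≫ γ) ≫ C.c := by
    rw [Category.assoc p, ← hx, ← reassoc_of% h₁, reassoc_of% S.hd_snd T, Category.assoc]
  let h' : X' ⟶ S.Triples T := S.trMk T (h ≫ S.trs T) (h ≫ S.trβ T)
    (T.ra (h ≫ S.trt T) (p ≫ γ) hγ) (by rw [Category.assoc, Category.assoc, trs_R])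
    (by rw [ra_L, Category.assoc, Category.assoc, trt_L])
  have e₁ : h' ≫ S.hd T = p ≫ pra T x γ hx := by
    rw [precomp_pra]
    ext
    · rw [Category.assoc, hd_fst, pra_fst, ← h₁, hd_fst', precomp_ra]
      exact ra_congr _ (trMk_s ..) (trMk_β ..)
    · rw [Category.assoc, hd_snd, pra_snd, trMk_t]
      refine ra_congr _ ?_ rfl
      rw [← h₁, Category.assoc, hd_snd]
  have e₂ : h' ≫ S.hc T = p ≫ pra T y γ hy := by
    rw [precomp_pra]
    ext
    · rw [Category.assoc, hc_fst, pra_fst, ← h₂, Category.assoc, hc_fst, trMk_s]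
    · rw [hc_snd', pra_snd, la_congr _ (trMk_β ..) (trMk_t ..),
        ← la_ra _ _ _ (by simp [trt_L]) hγ]
      refine ra_congr _ ?_ rfl
      rw [← h₂, hc_snd']
  rw [← cancel_epi p, ← reassoc_of% e₁, ← reassoc_of% e₂, hd_π]

end

lemma exists_tensorLam : ∃ l : pullback A.d (S.tensorL T) ⟶ S.tensorObj T,
    ∀ {X : E} (α : X ⟶ A.C₁) (z : X ⟶ S.Pairs T)
      (h : α ≫ A.d = z ≫ pullback.fst S.R T.L ≫ S.L),
      pullback.lift α (z ≫ S.tensorπ T) (by rw [h, Category.assoc, tensorπ_L]) ≫ l =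
        pla T α z h ≫ S.tensorπ T := by
  let f := pullback.fst (pullback.snd A.d (S.tensorL T)) (S.tensorπ T)
  let z₀ := pullback.snd (pullback.snd A.d (S.tensorL T)) (S.tensorπ T)
  have hf : f ≫ pullback.snd A.d (S.tensorL T) = z₀ ≫ S.tensorπ T := pullback.condition
  have h₀ : (f ≫ pullback.fst A.d (S.tensorL T)) ≫ A.d =
      z₀ ≫ pullback.fst S.R T.L ≫ S.L := by
    rw [Category.assoc, pullback.condition, reassoc_of% hf, tensorπ_L]
  obtain ⟨l, hl⟩ := exists_desc f (pla T _ z₀ h₀ ≫ S.tensorπ T) (by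
    intro W u v huv
    rw [← Category.assoc, ← Category.assoc, precomp_pla, precomp_pla,
      pla_congr _ (show _ = v ≫ f ≫ _ by rw [reassoc_of% huv]) rfl]
    apply pla_π_eq
    rw [Category.assoc, Category.assoc, ← hf, reassoc_of% huv])
  refine ⟨l, fun {X} α z h => ?_⟩
  let k := pullback.lift (f := pullback.snd A.d (S.tensorL T)) (g := S.tensorπ T)
    (pullback.lift α (z ≫ S.tensorπ T) (by rw [h, Category.assoc, tensorπ_L])) z
    (by rw [pullback.lift_snd])
  have k₁ : k ≫ f = pullback.lift α (z ≫ S.tensorπ T)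
    (by rw [h, Category.assoc, tensorπ_L]) := pullback.lift_fst ..
  have k₂ : k ≫ z₀ = z := pullback.lift_snd ..
  rw [← k₁, Category.assoc, hl, ← Category.assoc, precomp_pla]
  congr 1
  refine pla_congr _ ?_ k₂
  rw [reassoc_of% k₁, pullback.lift_fst]

lemma exists_tensorRho : ∃ l : pullback (S.tensorR T) C.c ⟶ S.tensorObj T,
    ∀ {X : E} (z : X ⟶ S.Pairs T) (γ : X ⟶ C.C₁)
      (h : z ≫ pullback.snd S.R T.L ≫ T.R = γ ≫ C.c),
      pullback.lift (z ≫ S.tensorπ T) γ (by rw [← h, Category.assoc, tensorπ_R]) ≫ l =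
        pra T z γ h ≫ S.tensorπ T := by
  let f := pullback.fst (pullback.fst (S.tensorR T) C.c) (S.tensorπ T)
  let z₀ := pullback.snd (pullback.fst (S.tensorR T) C.c) (S.tensorπ T)
  have hf : f ≫ pullback.fst (S.tensorR T) C.c = z₀ ≫ S.tensorπ T := pullback.condition
  have h₀ : z₀ ≫ pullback.snd S.R T.L ≫ T.R =
      (f ≫ pullback.snd (S.tensorR T) C.c) ≫ C.c := by
    rw [Category.assoc, ← pullback.condition, reassoc_of% hf, tensorπ_R]
  obtain ⟨l, hl⟩ := exists_desc f (pra T z₀ _ h₀ ≫ S.tensorπ T) (by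
    intro W u v huv
    rw [← Category.assoc, ← Category.assoc, precomp_pra, precomp_pra,
      pra_congr _ rfl (show _ = v ≫ f ≫ _ by rw [reassoc_of% huv])]
    apply pra_π_eq
    rw [Category.assoc, Category.assoc, ← hf, reassoc_of% huv])
  refine ⟨l, fun {X} z γ h => ?_⟩
  let k := pullback.lift (f := pullback.fst (S.tensorR T) C.c) (g := S.tensorπ T)
    (pullback.lift (z ≫ S.tensorπ T) γ (by rw [← h, Category.assoc, tensorπ_R])) z
    (by rw [pullback.lift_fst])
  have k₁ : k ≫ f = pullback.lift (z ≫ S.tensorπ T) γ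
    (by rw [← h, Category.assoc, tensorπ_R]) := pullback.lift_fst ..
  have k₂ : k ≫ z₀ = z := pullback.lift_snd ..
  rw [← k₁, Category.assoc, hl, ← Category.assoc, precomp_pra]
  congr 1
  refine pra_congr _ k₂ ?_
  rw [reassoc_of% k₁, pullback.lift_snd]

/-- The left action on `(T ⊗ S)₀` induced from `λ_S`: the unique morphism with
`α · Q₀(s, t) = Q₀(α · s, t)`. -/
noncomputable def tensorLam : pullback A.d (S.tensorL T) ⟶ S.tensorObj T :=
  (S.exists_tensorLam T).choose

/-- The right action on `(T ⊗ S)₀` induced from `ρ_T`: the unique morphism with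
`Q₀(s, t) · γ = Q₀(s, t · γ)`. -/
noncomputable def tensorRho : pullback (S.tensorR T) C.c ⟶ S.tensorObj T :=
  (S.exists_tensorRho T).choose

section
variable {S T}

lemma lift_tensorLam (α : X ⟶ A.C₁) (z : X ⟶ S.Pairs T)
    (h : α ≫ A.d = z ≫ pullback.fst S.R T.L ≫ S.L) {y : X ⟶ S.tensorObj T}
    (hy : y = z ≫ S.tensorπ T) {w : α ≫ A.d = y ≫ S.tensorL T} :
    pullback.lift α y w ≫ S.tensorLam T = pla T α z h ≫ S.tensorπ T := by
  subst hy; exact (S.exists_tensorLam T).choose_spec α z h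

lemma lift_tensorRho (z : X ⟶ S.Pairs T) (γ : X ⟶ C.C₁)
    (h : z ≫ pullback.snd S.R T.L ≫ T.R = γ ≫ C.c) {y : X ⟶ S.tensorObj T}
    (hy : y = z ≫ S.tensorπ T) {w : y ≫ S.tensorR T = γ ≫ C.c} :
    pullback.lift y γ w ≫ S.tensorRho T = pra T z γ h ≫ S.tensorπ T := by
  subst hy; exact (S.exists_tensorRho T).choose_spec z γ h

lemma exists_pair (y : X ⟶ S.tensorObj T) : ∃ (X' : E) (p : X' ⟶ X) (z : X' ⟶ S.Pairs T),
    Epi p ∧ p ≫ y = z ≫ S.tensorπ T :=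
  ⟨_, pullback.fst y (S.tensorπ T), pullback.snd y (S.tensorπ T), inferInstance,
    pullback.condition⟩

lemma precomp_tensorLam (k : X ⟶ pullback A.d (S.tensorL T)) (z : X ⟶ S.Pairs T)
    (hz : k ≫ pullback.snd A.d (S.tensorL T) = z ≫ S.tensorπ T) :
    k ≫ S.tensorLam T = pla T (k ≫ pullback.fst A.d (S.tensorL T)) z
      (by rw [Category.assoc, pullback.condition, reassoc_of% hz, tensorπ_L]) ≫ S.tensorπ T := by
  rw [← lift_tensorLam (k ≫ pullback.fst A.d (S.tensorL T)) z
    (by rw [Category.assoc, pullback.condition, reassoc_of% hz, tensorπ_L]) hz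
    (w := by rw [Category.assoc, Category.assoc, pullback.condition])]
  congr 1
  ext <;> simp

lemma precomp_tensorRho (k : X ⟶ pullback (S.tensorR T) C.c) (z : X ⟶ S.Pairs T)
    (hz : k ≫ pullback.fst (S.tensorR T) C.c = z ≫ S.tensorπ T) :
    k ≫ S.tensorRho T = pra T z (k ≫ pullback.snd (S.tensorR T) C.c)
      (by rw [Category.assoc, ← pullback.condition, reassoc_of% hz, tensorπ_R]) ≫
        S.tensorπ T := by
  rw [← lift_tensorRho z (k ≫ pullback.snd (S.tensorR T) C.c)
    (by rw [Category.assoc, ← pullback.condition, reassoc_of% hz, tensorπ_R]) hz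
    (w := by rw [Category.assoc, Category.assoc, pullback.condition])]
  congr 1
  ext <;> simp

lemma comp_lift_assoc {K L M N : E} {f : K ⟶ M} {g : L ⟶ M} (p : Y ⟶ X) (a : X ⟶ K) (b : X ⟶ L)
    (w : a ≫ f = b ≫ g) (l : pullback f g ⟶ N) :
    p ≫ pullback.lift a b w ≫ l = pullback.lift (p ≫ a) (p ≫ b) (by simp [w]) ≫ l := by
  rw [← Category.assoc]
  congr 1
  ext <;> simp

end

/-- The composite `T ⊗ S` of internal distributors. -/
noncomputable def tensor : Distributor A C where
  S₀ := S.tensorObj T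
  L := S.tensorL T
  R := S.tensorR T
  lam := S.tensorLam T
  rho := S.tensorRho T
  lam_L := by
    obtain ⟨X', p, z, hp, hz⟩ := exists_pair (pullback.snd A.d (S.tensorL T))
    rw [← cancel_epi p, ← Category.assoc, precomp_tensorLam p z hz, Category.assoc, pla_π_L,
      Category.assoc]
  lam_R := by
    obtain ⟨X', p, z, hp, hz⟩ := exists_pair (pullback.snd A.d (S.tensorL T))
    rw [← cancel_epi p, ← Category.assoc, precomp_tensorLam p z hz, Category.assoc, tensorπ_R,
      ← Category.assoc, pla_snd, reassoc_of% hz, tensorπ_R, Category.assoc]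
  rho_L := by
    obtain ⟨X', p, z, hp, hz⟩ := exists_pair (pullback.fst (S.tensorR T) C.c)
    rw [← cancel_epi p, ← Category.assoc, precomp_tensorRho p z hz, Category.assoc, tensorπ_L,
      ← Category.assoc, pra_fst, reassoc_of% hz, tensorπ_L, Category.assoc]
  rho_R := by
    obtain ⟨X', p, z, hp, hz⟩ := exists_pair (pullback.fst (S.tensorR T) C.c)
    rw [← cancel_epi p, ← Category.assoc, precomp_tensorRho p z hz, Category.assoc, pra_π_R,
      Category.assoc]
  lam_unit := by
    rw [← cancel_epi (S.tensorπ T), comp_lift_assoc,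
      lift_tensorLam _ (𝟙 _) (by simp [A.e_d]) (by simp)]
    refine Eq.trans ?_ ((Category.id_comp _).trans (Category.comp_id _).symm)
    congr 1
    ext
    · rw [pla_fst]
      refine Eq.trans (la_congr _ ?_ rfl) (la_unit _ _ rfl)
      rw [← Category.assoc, tensorπ_L, Category.id_comp]
    · rw [pla_snd]
  rho_unit := by
    rw [← cancel_epi (S.tensorπ T), comp_lift_assoc,
      lift_tensorRho (𝟙 _) _ (by simp [C.e_c]) (by simp)]
    refine Eq.trans ?_ ((Category.id_comp _).trans (Category.comp_id _).symm)
    congr 1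
    ext
    · rw [pra_fst]
    · rw [pra_snd]
      refine Eq.trans (ra_congr _ rfl ?_) (ra_unit _ _ rfl)
      rw [← Category.assoc, tensorπ_R, Category.id_comp]
  lam_assoc α α' s h hs := by
    obtain ⟨X', p, z, hp, hz⟩ := exists_pair s
    have h₁ : (p ≫ α) ≫ A.d = z ≫ pullback.fst S.R T.L ≫ S.L := by
      rw [Category.assoc, hs, reassoc_of% hz, tensorπ_L]
    have h₂ : (p ≫ α) ≫ A.c = (p ≫ α') ≫ A.d := by rw [Category.assoc, Category.assoc, h]
    rw [← cancel_epi p, comp_lift_assoc, comp_lift_assoc,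
      lift_tensorLam _ z (by rw [IntGpd.precomp, IntGpd.comp_d, h₁]) hz,
      lift_tensorLam _ (pla T (p ≫ α) z h₁)
        (by rw [← Category.assoc, pla_fst, la_L, h₂])
        ((comp_lift_assoc ..).trans (lift_tensorLam _ z h₁ hz))]
    congr 1
    ext
    · rw [pla_fst, pla_fst, la_congr _ (IntGpd.precomp ..) rfl,
        la_la _ _ _ h₂ (by rw [h₁, Category.assoc])]
      exact la_congr _ rfl (pla_fst ..).symm
    · rw [pla_snd, pla_snd, pla_snd]
  rho_assoc s β' β h hs := by
    obtain ⟨X', p, z, hp, hz⟩ := exists_pair s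
    have h₁ : z ≫ pullback.snd S.R T.L ≫ T.R = (p ≫ β) ≫ C.c := by
      rw [Category.assoc, ← hs, reassoc_of% hz, tensorπ_R]
    have h₂ : (p ≫ β') ≫ C.c = (p ≫ β) ≫ C.d := by rw [Category.assoc, Category.assoc, h]
    rw [← cancel_epi p, comp_lift_assoc, comp_lift_assoc,
      lift_tensorRho z _ (by rw [IntGpd.precomp, IntGpd.comp_c, h₁]) hz,
      lift_tensorRho (pra T z (p ≫ β) h₁) _
        (by rw [← Category.assoc, pra_snd, ra_R, h₂])
        ((comp_lift_assoc ..).trans (lift_tensorRho z _ h₁ hz))]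
    congr 1
    ext
    · rw [pra_fst, pra_fst, pra_fst]
    · rw [pra_snd, pra_snd, ra_congr _ rfl (IntGpd.precomp ..),
        ra_ra _ _ _ h₂ (by rw [← h₁, Category.assoc])]
      exact ra_congr _ (pra_snd ..).symm rfl
  compat α s β h h' := by
    obtain ⟨X', p, z, hp, hz⟩ := exists_pair s
    have h₁ : (p ≫ α) ≫ A.d = z ≫ pullback.fst S.R T.L ≫ S.L := by
      rw [Category.assoc, h, reassoc_of% hz, tensorπ_L]
    have h₂ : z ≫ pullback.snd S.R T.L ≫ T.R = (p ≫ β) ≫ C.c := by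
      rw [Category.assoc, ← h', reassoc_of% hz, tensorπ_R]
    rw [← cancel_epi p]
    refine (comp_lift_assoc ..).trans (Eq.trans ?_ (comp_lift_assoc ..).symm)
    refine (lift_tensorRho (pla T (p ≫ α) z h₁) _
      (by rw [← Category.assoc, pla_snd, Category.assoc, h₂])
      ((comp_lift_assoc ..).trans (lift_tensorLam _ z h₁ hz))).trans (Eq.trans ?_
      (lift_tensorLam _ (pra T z (p ≫ β) h₂)
        (by rw [← Category.assoc (pra T z (p ≫ β) h₂), pra_fst, h₁, Category.assoc])
        ((comp_lift_assoc ..).trans (lift_tensorRho z _ h₂ hz))).symm)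
    congr 1
    ext
    · rw [pra_fst, pla_fst, pla_fst]
      exact la_congr _ rfl (pra_fst ..).symm
    · exact (pra_snd ..).trans ((ra_congr _ (pla_snd ..) rfl).trans
        ((pla_snd ..).trans (pra_snd ..)).symm)

end Distributor

end Exact

end InternalGpd

open InternalGpd

/-!
The functor `P` is a discrete fibration because the actions of a groupoid are invertible: in a
square `α · s = s' · β` the object `s` is `α⁻¹ · (s' · β)`. Since discrete fibrations are right
orthogonal to final functors, everything else reduces to showing that `Q` is final and essentially
surjective, and both follow from `Q` being full and a regular epimorphism on objects: objects
identified by `Q₀` are then locally joined by an arrow over an identity, which every functor over a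
discrete fibration must send to an identity, so that morphisms out of the objects descend
along `Q₀`.

For fullness, an arrow `(s, t) ⟶ (s', t')` of `T ◇ S` over `(α, γ)` is the same thing as a
triple `(s', β, t)` relating `α · (s, t)` to `(s', t') · γ`. As `E` is exact, pairs identified
by `Q₀` are related by such a triple after passing to a regular epimorphic cover.
-/

namespace InternalGpd

section RegularEpi

variable {E : Type u} [Category.{v} E] [Regular E] {X Y Z : E}

lemma isRegularEpi_comp (f : X ⟶ Y) (g : Y ⟶ Z) [IsRegularEpi f] [IsRegularEpi g] :
    IsRegularEpi (f ≫ g) :=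
  have : StrongEpi (f ≫ g) := strongEpi_comp f g
  inferInstance

lemma isRegularEpi_of_isRegularEpi_comp (f : X ⟶ Y) (g : Y ⟶ Z) [IsRegularEpi (f ≫ g)] :
    IsRegularEpi g :=
  have : StrongEpi g := strongEpi_of_strongEpi f g
  inferInstance

lemma isRegularEpi_iff_exists_lift {f : X ⟶ Y} :
    IsRegularEpi f ↔ ∀ {W : E} (y : W ⟶ Y), ∃ (W' : E) (p : W' ⟶ W) (x : W' ⟶ X),
      IsRegularEpi p ∧ x ≫ f = p ≫ y := by
  constructor
  · intro _ W y
    exact ⟨_, pullback.fst y f, pullback.snd y f, inferInstance, pullback.condition.symm⟩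
  · intro h
    obtain ⟨_, p, x, hp, hx⟩ := h (𝟙 Y)
    have : IsRegularEpi (x ≫ f) := by rwa [hx, Category.comp_id]
    exact isRegularEpi_of_isRegularEpi_comp x f

end RegularEpi

section FullComparison

variable {E : Type u} [Category.{v} E] [HasFiniteLimits E] {G H : IntGpd E} {X : E}

lemma comp_fullComparison_eq_iff (F : G ⟶ H) {g : X ⟶ G.C₁}
    {l : X ⟶ pullback (prod.map F.F₀ F.F₀) (prod.lift H.d H.c)} :
    g ≫ fullComparison F = l ↔ g ≫ G.d = l ≫ pullback.fst _ _ ≫ prod.fst ∧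
      g ≫ G.c = l ≫ pullback.fst _ _ ≫ prod.snd ∧ g ≫ F.F₁ = l ≫ pullback.snd _ _ := by
  constructor
  · rintro rfl
    simp only [fullComparison, Category.assoc, pullback.lift_fst_assoc, pullback.lift_snd,
      prod.lift_fst, prod.lift_snd, and_self]
  · rintro ⟨hd, hc, h₁⟩
    apply pullback.hom_ext
    · ext <;> simp [fullComparison, pullback.lift_fst, prod.lift_fst, prod.lift_snd, hd, hc]
    · simp [fullComparison, pullback.lift_snd, h₁]

end FullComparison

section Full

variable {E : Type u} [Category.{v} E] [Regular E] {G H : IntGpd E} {F : G ⟶ H}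

lemma isFull_iff_exists_lift :
    IsFull F ↔ ∀ {X : E} (a b : X ⟶ G.C₀) (k : X ⟶ H.C₁),
      k ≫ H.d = a ≫ F.F₀ → k ≫ H.c = b ≫ F.F₀ →
        ∃ (X' : E) (p : X' ⟶ X) (g : X' ⟶ G.C₁), IsRegularEpi p ∧
          g ≫ G.d = p ≫ a ∧ g ≫ G.c = p ≫ b ∧ g ≫ F.F₁ = p ≫ k := by
  rw [IsFull, isRegularEpi_iff_exists_lift]
  constructor
  · intro h X a b k hd hc
    obtain ⟨X', p, g, hp, hg⟩ := h (pullback.lift (f := prod.map F.F₀ F.F₀)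
      (g := prod.lift H.d H.c) (prod.lift a b) k (by ext <;> simp [hd, hc]))
    refine ⟨X', p, g, hp, ?_⟩
    simpa only [Category.assoc, pullback.lift_fst_assoc, pullback.lift_snd, prod.lift_fst,
      prod.lift_snd] using (comp_fullComparison_eq_iff F).1 hg
  · intro h X l
    have w : l ≫ pullback.fst _ _ ≫ prod.map F.F₀ F.F₀ =
        l ≫ pullback.snd _ _ ≫ prod.lift H.d H.c := by rw [pullback.condition]
    have hd := congrArg (fun t => t ≫ prod.fst) w
    have hc := congrArg (fun t => t ≫ prod.snd) w
    simp only [Category.assoc, prod.map_fst, prod.map_snd, prod.lift_fst, prod.lift_snd] at hd hc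
    obtain ⟨X', p, g, hp, hg⟩ := h (l ≫ pullback.fst _ _ ≫ prod.fst)
      (l ≫ pullback.fst _ _ ≫ prod.snd) (l ≫ pullback.snd _ _)
      (by simpa using hd.symm) (by simpa using hc.symm)
    exact ⟨X', p, g, hp, (comp_fullComparison_eq_iff F).2 (by simpa using hg)⟩

lemma IsFull.isRegularEpi_F₁ (hF : IsFull F) [IsRegularEpi F.F₀] : IsRegularEpi F.F₁ := by
  refine isRegularEpi_iff_exists_lift.2 fun {X} k => ?_
  obtain ⟨X₁, p₁, a, _, ha⟩ := isRegularEpi_iff_exists_lift.1 ‹IsRegularEpi F.F₀› (k ≫ H.d)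
  obtain ⟨X₂, p₂, b, _, hb⟩ := isRegularEpi_iff_exists_lift.1 ‹IsRegularEpi F.F₀› (p₁ ≫ k ≫ H.c)
  obtain ⟨X₃, p₃, g, _, -, -, hg⟩ := isFull_iff_exists_lift.1 hF (p₂ ≫ a) b (p₂ ≫ p₁ ≫ k)
    (by simp [ha]) (by simp [hb])
  have : IsRegularEpi (p₂ ≫ p₁) := isRegularEpi_comp p₂ p₁
  exact ⟨X₃, p₃ ≫ p₂ ≫ p₁, g, isRegularEpi_comp p₃ (p₂ ≫ p₁), by simpa using hg⟩

lemma IsFull.exists_desc_F₀ (hF : IsFull F) [IsRegularEpi F.F₀] {Z : E} (k : G.C₀ ⟶ Z)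
    (hk : ∀ {X : E} (g : X ⟶ G.C₁) (y : X ⟶ H.C₀), g ≫ F.F₁ = y ≫ H.e →
      g ≫ G.d ≫ k = g ≫ G.c ≫ k) :
    ∃ l : H.C₀ ⟶ Z, F.F₀ ≫ l = k := by
  refine exists_desc F.F₀ k fun {X} a b hab => ?_
  obtain ⟨X', p, g, _, hd, hc, h₁⟩ := isFull_iff_exists_lift.1 hF a b (a ≫ F.F₀ ≫ H.e)
    (by simp [H.e_d]) (by simp [H.e_c, hab])
  rw [← cancel_epi p, ← reassoc_of% hd, ← reassoc_of% hc]
  exact hk g (p ≫ a ≫ F.F₀) (by simpa using h₁)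

end Full

section DiscreteFibration

variable {E : Type u} [Category.{v} E] [HasFiniteLimits E] {G H K : IntGpd E} {p : G ⟶ H}

lemma IsDiscreteFibration.hom_ext (hp : IsDiscreteFibration p) {X : E} {f g : X ⟶ G.C₁}
    (h₁ : f ≫ p.F₁ = g ≫ p.F₁) (hc : f ≫ G.c = g ≫ G.c) : f = g :=
  IsPullback.hom_ext hp h₁ hc

lemma IsDiscreteFibration.functor_ext (hp : IsDiscreteFibration p) {w w' : K ⟶ G}
    (h₀ : w.F₀ = w'.F₀) (h : w ≫ p = w' ≫ p) : w = w' :=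
  IntFunctor.hom_ext h₀
    (hp.hom_ext (congrArg IntFunctor.F₁ h) (by rw [w.map_c, w'.map_c, h₀]))

lemma IsDiscreteFibration.comp_d_eq_comp_c (hp : IsDiscreteFibration p) {X : E} {f : X ⟶ G.C₁}
    {y : X ⟶ H.C₀} (h : f ≫ p.F₁ = y ≫ H.e) : f ≫ G.d = f ≫ G.c := by
  have hy : f ≫ G.c ≫ p.F₀ = y := by
    rw [← p.map_c, reassoc_of% h, H.e_c, Category.comp_id]
  have f_eq_id : f = f ≫ G.c ≫ G.e := hp.hom_ext
    (by simp only [Category.assoc, p.map_e, h, reassoc_of% hy])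
    (by simp only [Category.assoc, G.e_c, Category.comp_id])
  calc f ≫ G.d = (f ≫ G.c ≫ G.e) ≫ G.d := by rw [← f_eq_id]
    _ = f ≫ G.c := by rw [Category.assoc, Category.assoc, G.e_d, Category.comp_id]

/-- The internal functor over `v` with prescribed components, which only have to respect domains
and codomains: arrows into a discrete fibration are determined by their image and codomain, so
identities and composites are preserved automatically. -/
def IsDiscreteFibration.liftFunctor (hp : IsDiscreteFibration p) (v : K ⟶ H) (w₀ : K.C₀ ⟶ G.C₀)
    (w₁ : K.C₁ ⟶ G.C₁) (h₀ : w₀ ≫ p.F₀ = v.F₀) (h₁ : w₁ ≫ p.F₁ = v.F₁)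
    (hd : w₁ ≫ G.d = K.d ≫ w₀) (hc : w₁ ≫ G.c = K.c ≫ w₀) : K ⟶ G where
  F₀ := w₀
  F₁ := w₁
  map_d := hd
  map_c := hc
  map_e := hp.hom_ext
    (by rw [Category.assoc, Category.assoc, h₁, p.map_e, v.map_e, reassoc_of% h₀])
    (by rw [Category.assoc, Category.assoc, hc, G.e_c, reassoc_of% K.e_c, Category.comp_id])
  map_m := hp.hom_ext
    (by
      rw [Category.assoc, h₁, v.map_m, p.map_comp]
      apply IntGpd.comp_congr <;> simp [h₁])
    (by
      refine Eq.trans ?_ (IntGpd.comp_c _ _ _).symm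
      rw [Category.assoc, hc, reassoc_of% K.m_c, Category.assoc, hc])

lemma IsDiscreteFibration.existsUnique_filler {G' H' : IntGpd E} {F : G' ⟶ H'} [Epi F.F₀]
    [Epi F.F₁] (hp : IsDiscreteFibration p) {u : G' ⟶ G} {v : H' ⟶ H} (sq : u ≫ p = F ≫ v)
    (w₀ : H'.C₀ ⟶ G.C₀) (hw₀ : F.F₀ ≫ w₀ = u.F₀) :
    ∃! w : H' ⟶ G, F ≫ w = u ∧ w ≫ p = v := by
  have sq₀ : u.F₀ ≫ p.F₀ = F.F₀ ≫ v.F₀ := congrArg IntFunctor.F₀ sq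
  have sq₁ : u.F₁ ≫ p.F₁ = F.F₁ ≫ v.F₁ := congrArg IntFunctor.F₁ sq
  have hwp₀ : w₀ ≫ p.F₀ = v.F₀ := by rw [← cancel_epi F.F₀, reassoc_of% hw₀, sq₀]
  obtain ⟨w₁, hwp₁, hwc⟩ := IsPullback.exists_lift hp v.F₁ (H'.c ≫ w₀)
    (by rw [Category.assoc, hwp₀, v.map_c])
  have hw₁ : F.F₁ ≫ w₁ = u.F₁ := hp.hom_ext (by rw [Category.assoc, hwp₁, sq₁])
    (by rw [Category.assoc, hwc, reassoc_of% F.map_c, hw₀, u.map_c])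
  have hwd : w₁ ≫ G.d = H'.d ≫ w₀ := by
    rw [← cancel_epi F.F₁, reassoc_of% hw₁, u.map_d, reassoc_of% F.map_d, hw₀]
  refine ⟨hp.liftFunctor v w₀ w₁ hwp₀ hwp₁ hwd hwc,
    ⟨IntFunctor.hom_ext hw₀ hw₁, IntFunctor.hom_ext hwp₀ hwp₁⟩, fun w' ⟨hFw', hw'p⟩ => ?_⟩
  refine hp.functor_ext ?_ (hw'p.trans (IntFunctor.hom_ext hwp₀ hwp₁).symm)
  rw [← cancel_epi F.F₀]
  exact (congrArg IntFunctor.F₀ hFw').trans hw₀.symm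

lemma IsFinal.existsUnique_iso {X Y Z Z' : IntGpd E} {F : X ⟶ Z} {K : Z ⟶ Y} {F' : X ⟶ Z'}
    {K' : Z' ⟶ Y} (hF : IsFinal F) (hK : IsDiscreteFibration K) (hF' : IsFinal F')
    (hK' : IsDiscreteFibration K') (h : F ≫ K = F' ≫ K') :
    ∃! i : Z ≅ Z', F ≫ i.hom = F' ∧ i.hom ≫ K' = K := by
  obtain ⟨f, ⟨hFf, hfK'⟩, huniq⟩ := hF K' hK' F' K h.symm
  obtain ⟨g, ⟨hF'g, hgK⟩, -⟩ := hF' K hK F K' h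
  have hfg : f ≫ g = 𝟙 Z := (hF K hK F K rfl).unique
    ⟨by rw [reassoc_of% hFf, hF'g], by rw [Category.assoc, hgK, hfK']⟩
    ⟨Category.comp_id _, Category.id_comp _⟩
  have hgf : g ≫ f = 𝟙 Z' := (hF' K' hK' F' K' rfl).unique
    ⟨by rw [reassoc_of% hF'g, hFf], by rw [Category.assoc, hfK', hgK]⟩
    ⟨Category.comp_id _, Category.id_comp _⟩
  exact ⟨⟨f, g, hfg, hgf⟩, ⟨hFf, hfK'⟩, fun i hi => Iso.ext (huniq i.hom hi)⟩

end DiscreteFibration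

lemma IsFull.isFinal {E : Type u} [Category.{v} E] [Regular E] {G H : IntGpd E} {F : G ⟶ H}
    (hF : IsFull F) [IsRegularEpi F.F₀] : IsFinal F := by
  intro X Y p hp u v sq
  have : IsRegularEpi F.F₁ := hF.isRegularEpi_F₁
  obtain ⟨w₀, hw₀⟩ := hF.exists_desc_F₀ u.F₀ fun g y hg => by
    have sq₁ : u.F₁ ≫ p.F₁ = F.F₁ ≫ v.F₁ := congrArg IntFunctor.F₁ sq
    have hu : (g ≫ u.F₁) ≫ p.F₁ = (y ≫ v.F₀) ≫ Y.e := by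
      rw [Category.assoc, sq₁, reassoc_of% hg, v.map_e, Category.assoc]
    simpa only [Category.assoc, u.map_d, u.map_c] using hp.comp_d_eq_comp_c hu
  exact hp.existsUnique_filler sq w₀ hw₀

section Pi0

variable {E : Type u} [Category.{v} E] [BarrExact E]

/-- The quotient morphism from the object of objects onto the object of connected components. -/
noncomputable def Pi0.π (G : IntGpd E) : G.C₀ ⟶ Pi0 G := coequalizer.π G.d G.c

instance (G : IntGpd E) : Epi (Pi0.π G) := inferInstanceAs (Epi (coequalizer.π G.d G.c))

lemma Pi0.condition (G : IntGpd E) : G.d ≫ Pi0.π G = G.c ≫ Pi0.π G :=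
  coequalizer.condition G.d G.c

variable {G H : IntGpd E}

lemma Pi0.π_map (F : G ⟶ H) : Pi0.π G ≫ Pi0.map F = F.F₀ ≫ Pi0.π H := coequalizer.π_desc _ _

lemma Pi0.exists_desc {X : E} (k : G.C₀ ⟶ X) (hk : G.d ≫ k = G.c ≫ k) :
    ∃ l : Pi0 G ⟶ X, Pi0.π G ≫ l = k :=
  ⟨coequalizer.desc k hk, coequalizer.π_desc _ _⟩

lemma IsFull.isEssSurj {F : G ⟶ H} (hF : IsFull F) [IsRegularEpi F.F₀] : IsEssSurj F := by
  have : IsRegularEpi F.F₁ := hF.isRegularEpi_F₁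
  obtain ⟨l, hl⟩ := hF.exists_desc_F₀ (Pi0.π G) fun g _ _ => by rw [Pi0.condition]
  obtain ⟨inv, hinv⟩ := Pi0.exists_desc (G := H) l (by
    rw [← cancel_epi F.F₁, reassoc_of% F.map_d, reassoc_of% F.map_c, hl, Pi0.condition])
  refine ⟨inv, ?_, ?_⟩
  · rw [← cancel_epi (Pi0.π G), reassoc_of% Pi0.π_map F, hinv, hl, Category.comp_id]
  · rw [← cancel_epi (Pi0.π H), ← cancel_epi F.F₀, reassoc_of% hinv, reassoc_of% hl, Pi0.π_map,
      Category.comp_id]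

end Pi0

namespace Distributor

section Total

variable {E : Type u} [Category.{v} E] [HasFiniteLimits E] {A B : IntGpd E} {S : Distributor A B}
  {X : E}

lemma la_inv_la (α : X ⟶ A.C₁) (s : X ⟶ S.S₀) (h : α ≫ A.d = s ≫ S.L) :
    S.la (α ≫ A.τ) (S.la α s h) (by rw [la_L, Category.assoc, A.τ_d]) = s := by
  rw [← la_la _ _ _ (by rw [Category.assoc, A.τ_d]), la_congr _ (IntGpd.comp_inv _) rfl]
  simpa only [Category.assoc] using la_unit s (α ≫ A.d) h.symm

lemma la_la_inv (α : X ⟶ A.C₁) (s : X ⟶ S.S₀) (h : (α ≫ A.τ) ≫ A.d = s ≫ S.L) :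
    S.la α (S.la (α ≫ A.τ) s h) (by rw [la_L, Category.assoc, A.τ_c]) = s := by
  rw [← la_la _ _ _ (by rw [Category.assoc, A.τ_c]), la_congr _ (IntGpd.inv_comp _) rfl]
  simpa only [Category.assoc] using
    la_unit s (α ≫ A.c) (by rw [← h, Category.assoc, A.τ_d])

lemma precomp_sq_comm (f : X ⟶ S.Sq) :
    S.la (f ≫ S.sqα) (f ≫ S.sqs) (by simp [sqα_d]) =
      S.ra (f ≫ S.sqs') (f ≫ S.sqβ) (by simp [sqβ_c]) := by
  rw [← precomp_la _ _ _ S.sqα_d, sq_comm, precomp_ra]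

lemma sqs_eq_la_inv (f : X ⟶ S.Sq) :
    f ≫ S.sqs = S.la ((f ≫ S.sqα) ≫ A.τ) (S.ra (f ≫ S.sqs') (f ≫ S.sqβ) (by simp [sqβ_c]))
      (by simp [ra_L, A.τ_d, sqα_c]) :=
  (la_inv_la _ _ (by simp [sqα_d])).symm.trans (la_congr _ rfl (precomp_sq_comm f))

lemma sq_ext_of_codomain {f g : X ⟶ S.Sq} (hα : f ≫ S.sqα = g ≫ S.sqα)
    (hs' : f ≫ S.sqs' = g ≫ S.sqs') (hβ : f ≫ S.sqβ = g ≫ S.sqβ) : f = g := by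
  refine sq_ext hα ?_ hs' hβ
  rw [sqs_eq_la_inv, sqs_eq_la_inv]
  exact la_congr _ (by rw [hα]) (ra_congr _ hs' hβ)

lemma exists_sq_of_codomain (α : X ⟶ A.C₁) (β : X ⟶ B.C₁) (s' : X ⟶ S.S₀)
    (hα : α ≫ A.c = s' ≫ S.L) (hβ : s' ≫ S.R = β ≫ B.c) :
    ∃ f : X ⟶ S.Sq, f ≫ S.sqα = α ∧ f ≫ S.sqβ = β ∧ f ≫ S.sqs' = s' := by
  have h : (α ≫ A.τ) ≫ A.d = S.ra s' β hβ ≫ S.L := by rw [Category.assoc, A.τ_d, hα, ra_L]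
  exact ⟨S.sqMk α (S.la (α ≫ A.τ) (S.ra s' β hβ) h) s' β
    (by rw [la_L, Category.assoc, A.τ_c]) hβ (la_la_inv _ _ h), by simp, by simp, by simp⟩

lemma isDiscreteFibration_leg (S : Distributor A B) : IsDiscreteFibration S.leg := by
  refine IsPullback.mk' S.leg.map_c (fun {X} (f g : X ⟶ S.Sq) h₁ hc => ?_)
    (fun {X} (k : X ⟶ A.C₁ ⨯ B.C₁) (s' : X ⟶ S.S₀)
      (h : k ≫ prod.map A.c B.c = s' ≫ prod.lift S.L S.R) => ?_)
  · have h₁ : f ≫ prod.lift S.sqα S.sqβ = g ≫ prod.lift S.sqα S.sqβ := h₁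
    have hα := congrArg (fun t => t ≫ prod.fst) h₁
    have hβ := congrArg (fun t => t ≫ prod.snd) h₁
    simp only [Category.assoc, prod.lift_fst, prod.lift_snd] at hα hβ
    exact sq_ext_of_codomain hα hc hβ
  · have hα := congrArg (fun t => t ≫ prod.fst) h
    have hβ := congrArg (fun t => t ≫ prod.snd) h
    simp only [Category.assoc, prod.map_fst, prod.map_snd, prod.lift_fst, prod.lift_snd] at hα hβ
    obtain ⟨f, hfα, hfβ, hfs'⟩ := exists_sq_of_codomain (S := S) (k ≫ prod.fst) (k ≫ prod.snd) s'
      (by rw [Category.assoc, hα]) (by rw [Category.assoc, hβ])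
    have hfk : f ≫ prod.lift S.sqα S.sqβ = k := by
      ext <;> simp only [Category.assoc, prod.lift_fst, prod.lift_snd, hfα, hfβ]
    exact ⟨f, hfk, hfs'⟩

end Total

section SpanComp

variable {E : Type u} [Category.{v} E] [HasFiniteLimits E] {A B C : IntGpd E}
  (S : Distributor A B) (T : Distributor B C)

/-- The projection of the arrows of the composite span `T ◇ S` to those of the span of `S`; its
codomain is written `S.Sq` so that the components of squares apply to it. -/
noncomputable def spanCompS : (S.spanComp T).C₁ ⟶ S.Sq := pullback.fst S.sqβ T.sqα

/-- The projection of the arrows of the composite span `T ◇ S` to those of the span of `T`; its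
codomain is written `T.Sq` so that the components of squares apply to it. -/
noncomputable def spanCompT : (S.spanComp T).C₁ ⟶ T.Sq := pullback.snd S.sqβ T.sqα

lemma spanComp_condition : S.spanCompS T ≫ S.sqβ = S.spanCompT T ≫ T.sqα := pullback.condition

variable {S T}

lemma exists_spanComp_lift {X : E} (σ : X ⟶ S.Sq) (θ : X ⟶ T.Sq) (w : σ ≫ S.sqβ = θ ≫ T.sqα) :
    ∃ g : X ⟶ (S.spanComp T).C₁, g ≫ S.spanCompS T = σ ∧ g ≫ S.spanCompT T = θ :=
  ⟨pullback.lift σ θ w, pullback.lift_fst .., pullback.lift_snd ..⟩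

end SpanComp

section Tensor

variable {E : Type u} [Category.{v} E] [BarrExact E] {A B C : IntGpd E}
  (S : Distributor A B) (T : Distributor B C) {X : E}

/-- The domain map of the composite span `T ◇ S`, with codomain written as the object of pairs. -/
noncomputable def spanCompD : (S.spanComp T).C₁ ⟶ S.Pairs T := (S.spanComp T).d

/-- The codomain map of the composite span `T ◇ S`, with codomain written as the object of
pairs. -/
noncomputable def spanCompC : (S.spanComp T).C₁ ⟶ S.Pairs T := (S.spanComp T).c

@[simp] lemma spanCompD_fst :
    S.spanCompD T ≫ pullback.fst S.R T.L = S.spanCompS T ≫ S.sqs := pullback.lift_fst ..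

@[simp] lemma spanCompD_snd :
    S.spanCompD T ≫ pullback.snd S.R T.L = S.spanCompT T ≫ T.sqs := pullback.lift_snd ..

@[simp] lemma spanCompC_fst :
    S.spanCompC T ≫ pullback.fst S.R T.L = S.spanCompS T ≫ S.sqs' := pullback.lift_fst ..

@[simp] lemma spanCompC_snd :
    S.spanCompC T ≫ pullback.snd S.R T.L = S.spanCompT T ≫ T.sqs' := pullback.lift_snd ..

lemma spanCompS_sqα_d : (S.spanCompS T ≫ S.sqα) ≫ A.d =
    S.spanCompD T ≫ pullback.fst S.R T.L ≫ S.L := by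
  rw [Category.assoc, sqα_d, reassoc_of% S.spanCompD_fst T]

lemma spanCompC_snd_R : S.spanCompC T ≫ pullback.snd S.R T.L ≫ T.R =
    (S.spanCompT T ≫ T.sqβ) ≫ C.c := by
  rw [Category.assoc, ← sqβ_c, reassoc_of% S.spanCompC_snd T]

/-- The triple `(s', β, t)` of an arrow `(α, β, γ) : (s, t) ⟶ (s', t')` of `T ◇ S`. It links
`α · (s, t)`, which is `(s' · β, t)`, to `(s', t') · γ`, which is `(s', β · t)`. -/
noncomputable def spanTriple : (S.spanComp T).C₁ ⟶ S.Triples T :=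
  S.trMk T (S.spanCompS T ≫ S.sqs') (S.spanCompS T ≫ S.sqβ) (S.spanCompT T ≫ T.sqs)
    (by rw [Category.assoc, sqβ_c, Category.assoc])
    (by rw [spanComp_condition, Category.assoc, sqα_d, Category.assoc])

lemma spanTriple_hd : S.spanTriple T ≫ S.hd T =
    pla T (S.spanCompS T ≫ S.sqα) (S.spanCompD T) (S.spanCompS_sqα_d T) := by
  ext
  · rw [spanTriple, hd_fst', pla_fst, ra_congr _ (trMk_s ..) (trMk_β ..), ← precomp_sq_comm]
    exact la_congr _ rfl (S.spanCompD_fst T).symm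
  · rw [Category.assoc, hd_snd, pla_snd, spanTriple, trMk_t, spanCompD_snd]

lemma spanTriple_hc : S.spanTriple T ≫ S.hc T =
    pra T (S.spanCompC T) (S.spanCompT T ≫ T.sqβ) (S.spanCompC_snd_R T) := by
  ext
  · rw [Category.assoc, hc_fst, pra_fst, spanTriple, trMk_s, spanCompC_fst]
  · rw [spanTriple, hc_snd', pra_snd,
      la_congr _ ((trMk_β ..).trans (S.spanComp_condition T)) (trMk_t ..), precomp_sq_comm]
    exact ra_congr _ (S.spanCompC_snd T).symm rfl

variable {S T}

lemma exists_spanComp_arrow {a b : X ⟶ S.Pairs T} {α : X ⟶ A.C₁} {γ : X ⟶ C.C₁}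
    {ha : α ≫ A.d = a ≫ pullback.fst S.R T.L ≫ S.L}
    {hb : b ≫ pullback.snd S.R T.L ≫ T.R = γ ≫ C.c} (h : X ⟶ S.Triples T)
    (h_hd : h ≫ S.hd T = pla T α a ha) (h_hc : h ≫ S.hc T = pra T b γ hb) :
    ∃ g : X ⟶ (S.spanComp T).C₁, g ≫ S.spanCompD T = a ∧ g ≫ S.spanCompC T = b ∧
      g ≫ S.spanCompS T ≫ S.sqα = α ∧ g ≫ S.spanCompT T ≫ T.sqβ = γ := by
  have hs : S.ra (h ≫ S.trs T) (h ≫ S.trβ T) (by simp [trs_R]) =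
      S.la α (a ≫ pullback.fst S.R T.L) (by rw [ha, Category.assoc]) := by
    rw [← hd_fst', h_hd, pla_fst]
  have ht : h ≫ S.trt T = a ≫ pullback.snd S.R T.L := by
    rw [← hd_snd, ← Category.assoc, h_hd, pla_snd]
  have hs' : h ≫ S.trs T = b ≫ pullback.fst S.R T.L := by
    rw [← hc_fst, ← Category.assoc, h_hc, pra_fst]
  have ht' : T.la (h ≫ S.trβ T) (h ≫ S.trt T) (by simp [trt_L]) =
      T.ra (b ≫ pullback.snd S.R T.L) γ (by rw [← hb, Category.assoc]) := by
    rw [← hc_snd', h_hc, pra_snd]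
  let σ : X ⟶ S.Sq := S.sqMk α (a ≫ pullback.fst S.R T.L) (h ≫ S.trs T) (h ≫ S.trβ T)
    (by rw [ha, Category.assoc]) (by simp [trs_R]) hs.symm
  let θ : X ⟶ T.Sq := T.sqMk (h ≫ S.trβ T) (h ≫ S.trt T) (b ≫ pullback.snd S.R T.L) γ
    (by simp [trt_L]) (by rw [← hb, Category.assoc]) ht'
  obtain ⟨g, hgS, hgT⟩ := exists_spanComp_lift σ θ (by simp [σ, θ])
  refine ⟨g, ?_, ?_, by rw [reassoc_of% hgS, sqMk_α], by rw [reassoc_of% hgT, sqMk_β]⟩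
  · ext
    · rw [Category.assoc, spanCompD_fst, reassoc_of% hgS, sqMk_s]
    · rw [Category.assoc, spanCompD_snd, reassoc_of% hgT, sqMk_s, ht]
  · ext
    · rw [Category.assoc, spanCompC_fst, reassoc_of% hgS, sqMk_s', hs']
    · rw [Category.assoc, spanCompC_snd, reassoc_of% hgT, sqMk_s']

lemma comp_tensorπ_L (z : X ⟶ S.Pairs T) :
    (z ≫ S.tensorπ T) ≫ (S.tensor T).L = z ≫ pullback.fst S.R T.L ≫ S.L :=
  (Category.assoc _ _ _).trans (congrArg (fun t => z ≫ t) (S.tensorπ_L T))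

lemma comp_tensorπ_R (z : X ⟶ S.Pairs T) :
    (z ≫ S.tensorπ T) ≫ (S.tensor T).R = z ≫ pullback.snd S.R T.L ≫ T.R :=
  (Category.assoc _ _ _).trans (congrArg (fun t => z ≫ t) (S.tensorπ_R T))

lemma tensor_la (α : X ⟶ A.C₁) (z : X ⟶ S.Pairs T)
    (h : α ≫ A.d = z ≫ pullback.fst S.R T.L ≫ S.L) :
    (S.tensor T).la α (z ≫ S.tensorπ T) (h.trans (comp_tensorπ_L z).symm) =
      pla T α z h ≫ S.tensorπ T :=
  lift_tensorLam α z h rfl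

lemma tensor_ra (z : X ⟶ S.Pairs T) (γ : X ⟶ C.C₁)
    (h : z ≫ pullback.snd S.R T.L ≫ T.R = γ ≫ C.c) :
    (S.tensor T).ra (z ≫ S.tensorπ T) γ ((comp_tensorπ_R z).trans h) =
      pra T z γ h ≫ S.tensorπ T :=
  lift_tensorRho z γ h rfl

variable (S T)

lemma tensor_la_spanCompD_eq_tensor_ra_spanCompC :
    (S.tensor T).la (S.spanCompS T ≫ S.sqα) (S.spanCompD T ≫ S.tensorπ T)
        ((S.spanCompS_sqα_d T).trans (comp_tensorπ_L _).symm) =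
      (S.tensor T).ra (S.spanCompC T ≫ S.tensorπ T) (S.spanCompT T ≫ T.sqβ)
        ((comp_tensorπ_R _).trans (S.spanCompC_snd_R T)) := by
  rw [tensor_la _ _ (S.spanCompS_sqα_d T), tensor_ra _ _ (S.spanCompC_snd_R T), ← spanTriple_hd,
    ← spanTriple_hc, Category.assoc, Category.assoc, hd_π]

/-- The arrow component `Q₁` of the comparison functor, sending `(α, β, γ) : (s, t) ⟶ (s', t')` to
the square `(α, γ) : Q₀(s, t) ⟶ Q₀(s', t')`. -/
noncomputable def tensorQ₁ : (S.spanComp T).C₁ ⟶ (S.tensor T).Sq :=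
  (S.tensor T).sqMk _ _ _ _ _ _ (S.tensor_la_spanCompD_eq_tensor_ra_spanCompC T)

@[simp] lemma tensorQ₁_α : S.tensorQ₁ T ≫ (S.tensor T).sqα = S.spanCompS T ≫ S.sqα := sqMk_α ..

@[simp] lemma tensorQ₁_s : S.tensorQ₁ T ≫ (S.tensor T).sqs = S.spanCompD T ≫ S.tensorπ T :=
  sqMk_s ..

@[simp] lemma tensorQ₁_s' : S.tensorQ₁ T ≫ (S.tensor T).sqs' = S.spanCompC T ≫ S.tensorπ T :=
  sqMk_s' ..

@[simp] lemma tensorQ₁_β : S.tensorQ₁ T ≫ (S.tensor T).sqβ = S.spanCompT T ≫ T.sqβ := sqMk_β ..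

lemma tensorπ_leg : S.tensorπ T ≫ (S.tensor T).leg.F₀ = (S.spanCompLeg T).F₀ :=
  (prod.comp_lift ..).trans (congrArg₂ prod.lift (S.tensorπ_L T) (S.tensorπ_R T))

lemma tensorQ₁_leg : S.tensorQ₁ T ≫ (S.tensor T).leg.F₁ = (S.spanCompLeg T).F₁ :=
  (prod.comp_lift ..).trans (congrArg₂ prod.lift (S.tensorQ₁_α T) (S.tensorQ₁_β T))

/-- The comparison functor `Q` from the composite span `T ◇ S` to the groupoid of the composite
distributor `T ⊗ S`. -/
noncomputable def tensorQ : S.spanComp T ⟶ (S.tensor T).total :=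
  (S.tensor T).isDiscreteFibration_leg.liftFunctor (S.spanCompLeg T) (S.tensorπ T)
    (S.tensorQ₁ T) (S.tensorπ_leg T) (S.tensorQ₁_leg T) (S.tensorQ₁_s T) (S.tensorQ₁_s' T)

lemma tensorQ_leg : S.tensorQ T ≫ (S.tensor T).leg = S.spanCompLeg T :=
  IntFunctor.hom_ext (S.tensorπ_leg T) (S.tensorQ₁_leg T)

instance : IsRegularEpi (S.tensorQ T).F₀ := inferInstanceAs (IsRegularEpi (S.tensorπ T))

lemma isFull_tensorQ : IsFull (S.tensorQ T) := by
  refine isFull_iff_exists_lift.2 ?_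
  intro X (a : X ⟶ S.Pairs T) (b : X ⟶ S.Pairs T) (k : X ⟶ (S.tensor T).Sq)
    (hd : k ≫ (S.tensor T).sqs = a ≫ S.tensorπ T) (hc : k ≫ (S.tensor T).sqs' = b ≫ S.tensorπ T)
  have ha : (k ≫ (S.tensor T).sqα) ≫ A.d = a ≫ pullback.fst S.R T.L ≫ S.L := by
    rw [Category.assoc, sqα_d, reassoc_of% hd]
    exact comp_tensorπ_L a
  have hb : b ≫ pullback.snd S.R T.L ≫ T.R = (k ≫ (S.tensor T).sqβ) ≫ C.c := by
    rw [Category.assoc, ← sqβ_c, reassoc_of% hc]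
    exact (comp_tensorπ_R b).symm
  have hab : pla T _ a ha ≫ S.tensorπ T = pra T b _ hb ≫ S.tensorπ T :=
    (tensor_la _ a ha).symm.trans <| (la_congr _ rfl hd.symm).trans <|
      (precomp_sq_comm k).trans <| (ra_congr _ hc rfl).trans (tensor_ra b _ hb)
  obtain ⟨X', p, h, hp, h_hd, h_hc⟩ := exists_triple _ _ hab
  rw [precomp_pla] at h_hd
  rw [precomp_pra] at h_hc
  obtain ⟨g, hgd, hgc, hgα, hgγ⟩ := exists_spanComp_arrow h h_hd h_hc
  refine ⟨X', p, g, hp, hgd, hgc, show g ≫ S.tensorQ₁ T = p ≫ k from sq_ext_of_codomain ?_ ?_ ?_⟩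
  · rw [Category.assoc, tensorQ₁_α, hgα, Category.assoc]
  · rw [Category.assoc, tensorQ₁_s', Category.assoc, hc]
    exact (reassoc_of% hgc) (S.tensorπ T)
  · rw [Category.assoc, tensorQ₁_β, hgγ, Category.assoc]

end Tensor

end Distributor

end InternalGpd

theorem mainTheorem3 {E : Type u} [Category.{v} E] [BarrExact E] {A B C : IntGpd E}
    (S : Distributor A B) (T : Distributor B C) :
    ∃ Q : S.spanComp T ⟶ (S.tensor T).total,
      (Q.F₀ = S.tensorπ T ∧ Q ≫ (S.tensor T).leg = S.spanCompLeg T) ∧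
      (∀ Q' : S.spanComp T ⟶ (S.tensor T).total,
        Q'.F₀ = S.tensorπ T → Q' ≫ (S.tensor T).leg = S.spanCompLeg T → Q' = Q) ∧
      IsFull Q ∧ IsEssSurj Q ∧ IsFinal Q ∧ IsDiscreteFibration (S.tensor T).leg ∧
      ∀ (Z : IntGpd E) (F : S.spanComp T ⟶ Z) (G : Z ⟶ A.prod C),
        IsFinal F → IsDiscreteFibration G → F ≫ G = S.spanCompLeg T →
          ∃! i : Z ≅ (S.tensor T).total, F ≫ i.hom = Q ∧ i.hom ≫ (S.tensor T).leg = G := by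
  have hP : IsDiscreteFibration (S.tensor T).leg := (S.tensor T).isDiscreteFibration_leg
  have hQ : IsFull (S.tensorQ T) := S.isFull_tensorQ T
  refine ⟨S.tensorQ T, ⟨rfl, S.tensorQ_leg T⟩,
    fun Q' h₀ h => hP.functor_ext h₀ (h.trans (S.tensorQ_leg T).symm),
    hQ, hQ.isEssSurj, hQ.isFinal, hP, fun Z F G hF hG h => ?_⟩
  exact hF.existsUnique_iso hG hQ.isFinal hP (h.trans (S.tensorQ_leg T).symm)
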